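/- **Setting.** Consider a game with finitely many players $i=1,\dots,N$. The action set of player $i$ is a nondegenerate compact interval $A^i\subset\mathbb R$ (that is, $A^i=[l_i,h_i]$ with $l_i<h_i$), and each player has a continuous (hence bounded) utility function $u^i:\underline A=\prod_{j}A^j\to\mathbb R$. The game is a *potential game*: there is $\phi:\underline A\to\mathbb R$ with $$u^i(a^i,a^{-i})-u^i(\tilde a^i,a^{-i})=\phi(a^i,a^{-i})-\phi(\tilde a^i,a^{-i})$$ for all $i$, $a^{-i}$, $a^i$, $\tilde a^i$. Let $\mathcal M(A^i)$ be the space of finite signed Borel measures on $A^i$ with the bounded Lipschitz norm $$\|\mu\|_{BL^i}=\sup\Big\{\Big|\int g\,d\mu\Big| : g:A^i\to\mathbb R,\ \sup_a|g(a)|+\sup_{a\ne b}\tfrac{|g(a)-g(b)|}{|a-b|}\le 1\Big\},$$ let $\Sigma=\prod_i\mathcal M(A^i)$ carry the norm $\|\mu\|_{BL}=\max_i\|\mu^i\|_{BL^i}$, and let $\Delta\subset\Sigma$ be the set of profiles $\pi=(\pi^1,\dots,\pi^N)$ of probability measures, with the metric induced by $\|\cdot\|_{BL}$. Write $u^i(a^i,\pi^{-i})$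 for the expected utility of player $i$ from the action $a^i$ when the other players' actions are drawn independently from $\pi^{-i}$. For $\eta>0$, the logit best response $L_\eta(\pi)=(L^1_\eta(\pi^{-1}),\dots,L^N_\eta(\pi^{-N}))\in\Delta$ is given by $$L^i_\eta(\pi^{-i})(B)=\frac{\int_B\exp\{\eta^{-1}u^i(a,\pi^{-i})\}\,da}{\int_{A^i}\exp\{\eta^{-1}u^i(b,\pi^{-i})\}\,db},\qquad B\subseteq A^i\text{ Borel},$$ and $\mathcal{LE}_\eta=\{\pi\in\Delta: L_\eta(\pi)=\pi\}$ is the set of logit equilibria. The connected components of $\mathcal{LE}_\eta$ are *isolated* if each of them has an open neighbourhood in $\Delta$ that contains no other point of $\mathcal{LE}_\eta$. Let $\Phi=(\Phi_t)_{t\ge0}$ be the (semi)flow on $\Delta$ induced by the logit best response dynamics $$\frac{d\pi}{dt}=L_\eta(\pi)-\pi,$$ the derivative being taken in $(\Sigma,\|\cdot\|_{BL})$. A set $\Lambda\subseteq\Delta$ is *internally chain transitive* for $\Phi$ if it is nonempty, compact and invariant ($\Phi_t(\Lambda)=\Lambda$ for all $t\ge0$), and if for all $a,b\in\Lambda$,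 $\delta>0$ and $T>0$ there are $k\ge1$, points $y_0,\dots,y_k\in\Lambda$ with $y_k=b$ and times $t_0,\dots,t_{k-1}\ge T$ such that $\|y_0-a\|_{BL}<\delta$ and $\|\Phi_{t_j}(y_j)-y_{j+1}\|_{BL}<\delta$ for $0\le j<k$. **Theorem.** Let $\eta>0$, and suppose that the connected components of $\mathcal{LE}_\eta$ are isolated. Then every internally chain transitive set $\Lambda\subseteq\Delta$ of $\Phi$ is contained in a single connected component of $\mathcal{LE}_\eta$. -/

import Mathlib

open MeasureTheory Set Filter Topology
open scoped NNReal ENNReal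

noncomputable section

/-! ### Signed measures with the bounded Lipschitz norm -/

/-- The test functions `g` with `sup |g| + Lip(g) ≤ 1`. (`M` bounds the supremum of `|g|` and `K`
bounds the Lipschitz quotients; the best such constants are the two suprema.) -/
def blTestFunctions (X : Type*) [MetricSpace X] : Set (X → ℝ) :=
  {g | ∃ M K : ℝ, 0 ≤ M ∧ 0 ≤ K ∧ M + K ≤ 1 ∧
    (∀ a, |g a| ≤ M) ∧ ∀ a b, |g a - g b| ≤ K * dist a b}

section

variable {X : Type*} [MetricSpace X]

theorem zero_mem_blTestFunctions : (fun _ => (0 : ℝ)) ∈ blTestFunctions X :=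
  ⟨0, 0, le_rfl, le_rfl, by norm_num, by simp, by simp⟩

instance : Nonempty (blTestFunctions X) := ⟨⟨_, zero_mem_blTestFunctions⟩⟩

theorem abs_le_one_of_mem_blTestFunctions {g : X → ℝ} (hg : g ∈ blTestFunctions X) (a : X) : |g a| ≤ 1 := by
  obtain ⟨M, K, hM, hK, hMK, h1, h2⟩ := hg
  linarith [h1 a]

theorem continuous_of_mem_blTestFunctions {g : X → ℝ} (hg : g ∈ blTestFunctions X) : Continuous g := by
  obtain ⟨M, K, hM, hK, hMK, h1, h2⟩ := hg
  exact (LipschitzWith.of_dist_le_mul (K := ⟨K, hK⟩) fun a b => h2 a b).continuous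

end

/-- The vector space of finite signed Borel measures on `X`, as a type of its own, so that it can
carry the bounded Lipschitz norm. -/
def BLMeasure (X : Type*) [MeasurableSpace X] : Type _ := SignedMeasure X

namespace BLMeasure

variable {X : Type*} [MeasurableSpace X]

instance : AddCommGroup (BLMeasure X) := inferInstanceAs (AddCommGroup (SignedMeasure X))

instance : Module ℝ (BLMeasure X) := inferInstanceAs (Module ℝ (SignedMeasure X))

/-- The integral of a real function against a finite signed measure. -/
def integral (μ : BLMeasure X) (g : X → ℝ) : ℝ :=
  VectorMeasure.integral (μ : SignedMeasure X) g (ContinuousLinearMap.lsmul ℝ ℝ).flip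

theorem integral_smul' (c : ℝ) (μ : BLMeasure X) (g : X → ℝ) :
    (c • μ).integral g = c * μ.integral g :=
  VectorMeasure.integral_smul_vectorMeasure (μ := (μ : SignedMeasure X)) g c

theorem isFiniteMeasure_variation (μ : SignedMeasure X) :
    IsFiniteMeasure (VectorMeasure.variation μ) := by
  rw [← SignedMeasure.totalVariation_eq_variation]
  unfold SignedMeasure.totalVariation
  infer_instance

variable [MetricSpace X]

/-- The bounded Lipschitz norm `‖μ‖ = sup { |∫ g dμ| : sup |g| + Lip(g) ≤ 1 }`. -/
instance : Norm (BLMeasure X) :=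
  ⟨fun μ => ⨆ g : blTestFunctions X, |μ.integral (g : X → ℝ)|⟩

theorem norm_def (μ : BLMeasure X) :
    ‖μ‖ = ⨆ g : blTestFunctions X, |μ.integral (g : X → ℝ)| := rfl

variable [BorelSpace X]

theorem integrable_of_mem (μ : SignedMeasure X) {g : X → ℝ} (hg : g ∈ blTestFunctions X) :
    VectorMeasure.Integrable μ g := by
  have := isFiniteMeasure_variation μ
  exact MeasureTheory.Integrable.of_bound (C := 1)
    (continuous_of_mem_blTestFunctions hg).measurable.aestronglyMeasurable
    (ae_of_all _ fun a => by simpa using abs_le_one_of_mem_blTestFunctions hg a)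

theorem integral_add' (μ ν : BLMeasure X) {g : X → ℝ} (hg : g ∈ blTestFunctions X) :
    (μ + ν).integral g = μ.integral g + ν.integral g :=
  VectorMeasure.integral_add_vectorMeasure (integrable_of_mem μ hg) (integrable_of_mem ν hg)

theorem bddAbove_range (μ : BLMeasure X) :
    BddAbove (range fun g : blTestFunctions X => |μ.integral (g : X → ℝ)|) := by
  have hfin := isFiniteMeasure_variation (X := X) μ
  refine ⟨‖(ContinuousLinearMap.lsmul ℝ ℝ (E := ℝ)).flip‖ *
    ∫ _, (1 : ℝ) ∂(VectorMeasure.variation (μ : SignedMeasure X)), ?_⟩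
  rintro _ ⟨g, rfl⟩
  refine (VectorMeasure.norm_integral_le_integral_norm (μ := (μ : SignedMeasure X))
    (B := (ContinuousLinearMap.lsmul ℝ ℝ (E := ℝ)).flip)).trans ?_
  refine mul_le_mul_of_nonneg_left ?_
    (norm_nonneg ((ContinuousLinearMap.lsmul ℝ ℝ).flip : ℝ →L[ℝ] ℝ →L[ℝ] ℝ))
  exact integral_mono (integrable_of_mem (X := X) μ g.2).norm (integrable_const _)
    fun a => abs_le_one_of_mem_blTestFunctions g.2 a

theorem abs_integral_le_norm (μ : BLMeasure X) {g : X → ℝ} (hg : g ∈ blTestFunctions X) :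
    |μ.integral g| ≤ ‖μ‖ :=
  le_ciSup (f := fun g : blTestFunctions X => |μ.integral (g : X → ℝ)|) (bddAbove_range μ) ⟨g, hg⟩

/-- A signed measure that integrates all test functions to zero vanishes. -/
theorem eq_zero_of_forall_integral (μ : BLMeasure X)
    (h : ∀ g ∈ blTestFunctions X, μ.integral g = 0) : μ = 0 := by
  set j := SignedMeasure.toJordanDecomposition (μ : SignedMeasure X) with hj
  have hμ : (μ : SignedMeasure X) = j.posPart.toSignedMeasure - j.negPart.toSignedMeasure :=
    (SignedMeasure.toSignedMeasure_toJordanDecomposition (μ : SignedMeasure X)).symm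
  have hint : ∀ g ∈ blTestFunctions X, ∫ x, g x ∂j.posPart = ∫ x, g x ∂j.negPart := by
    intro g hg
    have h0 := h g hg
    unfold integral at h0
    rw [hμ, VectorMeasure.integral_sub_vectorMeasure (integrable_of_mem _ hg)
      (integrable_of_mem _ hg), VectorMeasure.integral_toSignedMeasure,
      VectorMeasure.integral_toSignedMeasure] at h0
    linarith
  have hthick : ∀ (δ : ℝ) (hδ : 0 < δ) (F : Set X),
      ∫ x, (thickenedIndicator hδ F x : ℝ) ∂j.posPart
        = ∫ x, (thickenedIndicator hδ F x : ℝ) ∂j.negPart := by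
    intro δ hδ F
    have hc : 0 < 1 + δ⁻¹ := by positivity
    have hmem : (fun x => (1 + δ⁻¹)⁻¹ * (thickenedIndicator hδ F x : ℝ)) ∈ blTestFunctions X := by
      refine ⟨(1 + δ⁻¹)⁻¹, (1 + δ⁻¹)⁻¹ * δ⁻¹, by positivity, by positivity, ?_, ?_, ?_⟩
      · rw [← mul_one_add, inv_mul_cancel₀ hc.ne']
      · intro a
        have h1 : (thickenedIndicator hδ F a : ℝ) ≤ 1 := by
          exact_mod_cast thickenedIndicator_le_one hδ F a
        rw [abs_of_nonneg (by positivity)]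
        exact mul_le_of_le_one_right (by positivity) h1
      · intro a b
        rw [← mul_sub, abs_mul, abs_of_nonneg (by positivity), mul_assoc]
        refine mul_le_mul_of_nonneg_left ?_ (by positivity)
        have h2 := (lipschitzWith_thickenedIndicator hδ F).dist_le_mul a b
        rw [NNReal.dist_eq] at h2
        simpa [Real.coe_toNNReal _ hδ.le] using h2
    have h3 := hint _ hmem
    rw [integral_const_mul, integral_const_mul] at h3
    exact mul_left_cancel₀ (by positivity) h3
  have hreal : ∀ F : Set X, IsClosed F → j.posPart F = j.negPart F := by
    intro F hF
    have h1 := tendsto_integral_thickenedIndicator_of_isClosed j.posPart hF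
      (δs := fun n : ℕ => 1 / ((n : ℝ) + 1)) (fun n => by positivity)
      tendsto_one_div_add_atTop_nhds_zero_nat
    have h2 := tendsto_integral_thickenedIndicator_of_isClosed j.negPart hF
      (δs := fun n : ℕ => 1 / ((n : ℝ) + 1)) (fun n => by positivity)
      tendsto_one_div_add_atTop_nhds_zero_nat
    simp_rw [hthick] at h1
    have h3 := tendsto_nhds_unique h1 h2
    exact (measureReal_eq_measureReal_iff).1 h3
  have heq : j.posPart = j.negPart := by
    apply ext_of_generate_finite _ ?_ isPiSystem_isClosed
    · exact fun F hF => hreal F hF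
    · exact hreal _ isClosed_univ
    · rw [BorelSpace.measurable_eq (α := X), borel_eq_generateFrom_isClosed]
  exact hμ.trans (sub_eq_zero.2 (Measure.toSignedMeasure_eq_toSignedMeasure_iff.2 heq))

theorem normedSpaceCore : NormedSpace.Core ℝ (BLMeasure X) where
  norm_nonneg μ := Real.iSup_nonneg fun _ => abs_nonneg _
  norm_smul c μ := by
    simp only [norm_def, integral_smul', abs_mul, Real.norm_eq_abs]
    exact (Real.mul_iSup_of_nonneg (abs_nonneg c) _).symm
  norm_triangle μ ν := by
    refine ciSup_le fun g => ?_
    rw [integral_add' μ ν g.2]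
    exact (abs_add_le _ _).trans
      (add_le_add (abs_integral_le_norm μ g.2) (abs_integral_le_norm ν g.2))
  norm_eq_zero_iff μ := by
    constructor
    · intro h
      refine eq_zero_of_forall_integral μ fun g hg => ?_
      have := abs_integral_le_norm μ hg
      rw [h] at this
      exact abs_nonpos_iff.1 this
    · rintro rfl
      have h0 : ∀ g : X → ℝ, (0 : BLMeasure X).integral g = 0 := fun g => by
        simpa using integral_smul' 0 (0 : BLMeasure X) g
      simp [norm_def, h0]

instance : NormedAddCommGroup (BLMeasure X) := NormedAddCommGroup.ofCore normedSpaceCore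

instance : NormedSpace ℝ (BLMeasure X) := NormedSpace.ofCore normedSpaceCore

end BLMeasure

/-! ### Mixed strategies -/

/-- Mixed strategies over the action space `X`: the Borel probability measures on `X`. -/
@[ext]
structure MixedStrategy (X : Type*) [MeasurableSpace X] where
  toMeasure : Measure X
  isProbabilityMeasure : IsProbabilityMeasure toMeasure

namespace MixedStrategy

variable {X : Type*} [MeasurableSpace X]

instance (π : MixedStrategy X) : IsProbabilityMeasure π.toMeasure := π.isProbabilityMeasure

/-- A mixed strategy as an element of the space of finite signed measures. -/
def toBL (π : MixedStrategy X) : BLMeasure X := π.toMeasure.toSignedMeasure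

theorem toBL_injective : Function.Injective (toBL : MixedStrategy X → BLMeasure X) := by
  intro π ρ h
  exact MixedStrategy.ext (Measure.toSignedMeasure_eq_toSignedMeasure_iff.1 h)

/-- The metric on mixed strategies is the one of the bounded Lipschitz norm,
`dist π ρ = ‖π - ρ‖`. -/
instance [MetricSpace X] [BorelSpace X] : MetricSpace (MixedStrategy X) :=
  MetricSpace.induced toBL toBL_injective inferInstance

end MixedStrategy

/-! ### Games with continuous action spaces -/

/-- An `N`-player game in which player `i` chooses an action in a (nondegenerate) compact interval
`[lo i, hi i]` and has a continuous (hence bounded) utility function on the joint actions. -/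
structure ContinuousActionGame (N : ℕ) where
  lo : Fin N → ℝ
  hi : Fin N → ℝ
  lo_lt_hi : ∀ i, lo i < hi i
  utility : Fin N → ((i : Fin N) → Icc (lo i) (hi i)) → ℝ
  continuous_utility : ∀ i, Continuous (utility i)

namespace ContinuousActionGame

variable {N : ℕ} (G : ContinuousActionGame N)

/-- The action space of player `i`. -/
abbrev Action (i : Fin N) : Type := Icc (G.lo i) (G.hi i)

/-- The set `Δ` of mixed strategy profiles; its metric is the maximum over the players of the
bounded Lipschitz distances. -/
abbrev Profile : Type := (i : Fin N) → MixedStrategy (G.Action i)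

/-- The normed space `Σ`, the product of the spaces of finite signed measures with the bounded
Lipschitz norm; its norm is the maximum over the players. -/
abbrev SignedProfile : Type := (i : Fin N) → BLMeasure (G.Action i)

/-- The inclusion of `Δ` in `Σ`. -/
def toSigned (π : G.Profile) : G.SignedProfile := fun i => (π i).toBL

/-- The game admits a potential function. -/
def IsPotentialGame : Prop :=
  ∃ φ : ((i : Fin N) → G.Action i) → ℝ, ∀ (i : Fin N) (a : (i : Fin N) → G.Action i)
    (b b' : G.Action i),
    G.utility i (Function.update a i b) - G.utility i (Function.update a i b')
      = φ (Function.update a i b) - φ (Function.update a i b')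

/-- `u^i(a^i, π^{-i})`: the expected utility of player `i` from the action `x` when the actions of
the others are drawn independently from `π` (the component `b i` is overwritten by `x`). -/
def expectedUtility (i : Fin N) (x : G.Action i) (π : G.Profile) : ℝ :=
  ∫ b, G.utility i (Function.update b i x) ∂(Measure.pi fun j => (π j).toMeasure)

theorem exists_bound (i : Fin N) : ∃ C, ∀ a, ‖G.utility i a‖ ≤ C := by
  obtain ⟨C, hC⟩ := isCompact_univ.exists_bound_of_continuousOn
    (G.continuous_utility i).continuousOn
  exact ⟨C, fun a => hC a (mem_univ a)⟩

theorem continuous_expectedUtility (i : Fin N) (π : G.Profile) :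
    Continuous fun x => G.expectedUtility i x π := by
  obtain ⟨C, hC⟩ := G.exists_bound i
  refine continuous_of_dominated (bound := fun _ => C) (fun x => ?_)
    (fun x => ae_of_all _ fun b => hC _) (integrable_const C) (ae_of_all _ fun b => ?_)
  · exact ((G.continuous_utility i).comp
      (continuous_id.update i continuous_const)).measurable.aestronglyMeasurable
  · exact (G.continuous_utility i).comp (continuous_const.update i continuous_id)

/-- Lebesgue measure on the action interval of player `i`. -/
def lebesgue (i : Fin N) : Measure (G.Action i) :=
  Measure.comap (Subtype.val : Icc (G.lo i) (G.hi i) → ℝ) volume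

theorem lebesgue_univ (i : Fin N) :
    G.lebesgue i univ = ENNReal.ofReal (G.hi i - G.lo i) := by
  unfold lebesgue
  rw [comap_subtype_coe_apply measurableSet_Icc, image_univ, Subtype.range_coe, Real.volume_Icc]

instance (i : Fin N) : IsFiniteMeasure (G.lebesgue i) :=
  ⟨by rw [lebesgue_univ]; exact ENNReal.ofReal_lt_top⟩

instance (i : Fin N) : NeZero (G.lebesgue i) := by
  refine ⟨fun h => ?_⟩
  have h1 := G.lebesgue_univ i
  rw [h] at h1
  have h2 := ENNReal.ofReal_eq_zero.1 h1.symm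
  linarith [G.lo_lt_hi i]

theorem integrable_exp (η : ℝ) (i : Fin N) (π : G.Profile) :
    Integrable (fun x => Real.exp (η⁻¹ * G.expectedUtility i x π)) (G.lebesgue i) :=
  (Real.continuous_exp.comp (continuous_const.mul
    (G.continuous_expectedUtility i π))).integrable_of_hasCompactSupport
      (HasCompactSupport.of_compactSpace _)

/-- The logit best response `L^i_η(π^{-i})` with noise level `η`: the probability measure whose
density with respect to Lebesgue measure on the action interval is
`exp (η⁻¹ u^i(x, π^{-i})) / ∫ exp (η⁻¹ u^i(y, π^{-i})) dy`. -/
def logitResponse (η : ℝ) (π : G.Profile) (i : Fin N) : MixedStrategy (G.Action i) :=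
  ⟨(G.lebesgue i).tilted fun x => η⁻¹ * G.expectedUtility i x π,
    isProbabilityMeasure_tilted (G.integrable_exp η i π)⟩

/-- The set `LE_η` of logit equilibria: the fixed points of the logit best response. -/
def logitEquilibria (η : ℝ) : Set G.Profile := {π | G.logitResponse η π = π}

/-- Every connected component of the set of logit equilibria is isolated: it has a neighbourhood
that contains no other logit equilibria. -/
def HasIsolatedEquilibriumComponents (η : ℝ) : Prop :=
  ∀ π ∈ G.logitEquilibria η, ∃ U : Set G.Profile, IsOpen U ∧
    connectedComponentIn (G.logitEquilibria η) π ⊆ U ∧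
    U ∩ G.logitEquilibria η ⊆ connectedComponentIn (G.logitEquilibria η) π

/-- The semiflow `Φ` on `Δ` is the one induced by the logit best response dynamics
`dπ/dt = L_η(π) - π`: each of its trajectories is a solution, differentiable in the bounded
Lipschitz norm (one-sidedly at time `0`). -/
def IsLogitFlow (η : ℝ) (Φ : Flow ℝ≥0 G.Profile) : Prop :=
  ∀ (π : G.Profile) (t : ℝ≥0),
    HasDerivWithinAt (fun s : ℝ => G.toSigned (Φ s.toNNReal π))
      (G.toSigned (G.logitResponse η (Φ t π)) - G.toSigned (Φ t π)) (Ici 0) (t : ℝ)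

end ContinuousActionGame

/-! ### Internally chain transitive sets -/

/-- There is a `(δ, T)`-pseudo-orbit in `Λ` from `a` to `b`: partial trajectories
`{Φ_s (y j) : 0 ≤ s ≤ t j}`, `j < k`, started in `Λ`, of lengths `t j ≥ T`, the first of which
starts within `δ` of `a`, each of which ends within `δ` of the start `y (j + 1)` of the next one,
where `y k = b`. -/
def HasPseudoOrbit {M : Type*} [MetricSpace M] (Φ : Flow ℝ≥0 M) (Λ : Set M) (δ : ℝ) (T : ℝ≥0)
    (a b : M) : Prop :=
  ∃ (k : ℕ) (y : ℕ → M) (t : ℕ → ℝ≥0), 0 < k ∧ (∀ j ≤ k, y j ∈ Λ) ∧ (∀ j < k, T ≤ t j) ∧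
    dist (y 0) a < δ ∧ (∀ j < k, dist (Φ (t j) (y j)) (y (j + 1)) < δ) ∧ y k = b

/-- `Λ` is internally chain transitive for the semiflow `Φ`: it is nonempty, compact and invariant
(`Φ_t(Λ) = Λ` for all `t ≥ 0`), and the restriction of `Φ` to `Λ` is chain transitive. -/
def IsInternallyChainTransitive {M : Type*} [MetricSpace M] (Φ : Flow ℝ≥0 M) (Λ : Set M) : Prop :=
  Λ.Nonempty ∧ IsCompact Λ ∧ (∀ t, Φ t '' Λ = Λ) ∧
    ∀ a ∈ Λ, ∀ b ∈ Λ, ∀ δ : ℝ, 0 < δ → ∀ T : ℝ≥0, 0 < T → HasPseudoOrbit Φ Λ δ T a b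

end

/-! The proof rests on a strict Lyapunov function whose values at equilibria are negligible.
Describe strategies by log-densities `v i` and put `ψ = η⁻¹ • φ`, with `φ` a continuous potential.
The free energy of a profile is the mean of `ψ` plus the entropy. Its derivative along the dynamics
is the sum over the players of `∫ (p - q) (log p - log q)`, where `p` is the density of the logit
response and `q` that of the current strategy. This is nonnegative and vanishes only at equilibria
(`fderiv_productFreeEnergy_logitField`).

Strict increase alone does not confine chain transitive sets to equilibria. It does when the
equilibrium values form a null set (`IsInternallyChainTransitive.subset_of_lyapunov`): if `V x < V
(Φ 1 x)`, some level strictly between is not an equilibrium value, and no chain with small enough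
jumps can cross it downwards to return to `x`.

That the values are null is a Sard theorem in infinite dimensions
(`volume_image_equilibriumLogDensities`). Equilibria are critical points of the free energy, which
is analytic in `v`, and they solve `v = gibbsPayoff v + const`, where `gibbsPayoff` averages a
compact family of payoff functions. Approximating this family uniformly by one with values in a
finite-dimensional subspace leaves a remainder `R` with `‖DR‖ ≤ 1/2`. The map `v ↦ v - R v` is then
an analytic change of coordinates that carries all equilibria into a finite-dimensional subspace,
where Morse–Sard for analytic functions applies.

A priori `Λ` consists of arbitrary probability measures, compared in a weak norm. But logit
responses have densities in a compact convex set bounded away from zero, the dynamics relaxes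
towards this set, and a compact invariant set must lie inside it (`mem_of_relaxation`). So
log-densities exist on `Λ`, range over a compact set, depend continuously on the profile, and solve
an ordinary differential equation in the uniform norm.

Thus `Λ` consists of equilibria, which are rest points. A chain in `Λ` is then a sequence of small
jumps, so `Λ` is connected and lies in one component. -/

noncomputable section

/-! ### Morse–Sard for real-valued analytic functions in finite dimension. -/

section MorseSard

open Module
open scoped ContDiff

/-- A local Taylor estimate, uniform in the base point, at points where the derivatives of orders
`1, …, k` vanish. -/
theorem AnalyticAt.exists_norm_sub_le_pow {E : Type} [NormedAddCommGroup E] [NormedSpace ℝ E]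
    (k : ℕ) : ∀ {G : Type} [NormedAddCommGroup G] [NormedSpace ℝ G] [CompleteSpace G] {F : E → G}
      {x₀ : E}, AnalyticAt ℝ F x₀ → ∃ C : ℝ, 0 ≤ C ∧ ∃ r > 0,
        ∀ x ∈ Metric.ball x₀ r, ∀ y ∈ Metric.ball x₀ r,
        (∀ j, 1 ≤ j → j ≤ k → iteratedFDeriv ℝ j F x = 0) → ‖F y - F x‖ ≤ C * ‖y - x‖ ^ (k + 1) := by
  induction k with
  | zero =>
    intro G _ _ _ F x₀ hF
    obtain ⟨K, t, ht, hK⟩ := (hF.contDiffAt (n := 1)).exists_lipschitzOnWith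
    obtain ⟨r, hr, hrt⟩ := Metric.mem_nhds_iff.1 ht
    refine ⟨K, K.2, r, hr, fun x hx y hy _ => ?_⟩
    simpa [dist_eq_norm] using hK.dist_le_mul y (hrt hy) x (hrt hx)
  | succ k ih =>
    intro G _ _ _ F x₀ hF
    -- The induction passes to the derivative, which is flat to one order less; this is why the
    -- target space is arbitrary.
    obtain ⟨C, hC, r, hr, h⟩ := ih hF.fderiv
    obtain ⟨r', hr', hd⟩ := Metric.mem_nhds_iff.1 hF.eventually_analyticAt
    refine ⟨C, hC, min r r', lt_min hr hr', fun x hx y hy hj => ?_⟩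
    have hx1 := Metric.ball_subset_ball (min_le_left r r') hx
    have h1 : fderiv ℝ F x = 0 := by
      have h2 := hj 1 le_rfl (by omega)
      have h3 := norm_iteratedFDeriv_fderiv (𝕜 := ℝ) (f := F) (x := x) (n := 0)
      rw [h2, norm_zero, norm_iteratedFDeriv_zero, norm_eq_zero] at h3
      exact h3
    have h4 : ∀ j, 1 ≤ j → j ≤ k → iteratedFDeriv ℝ j (fderiv ℝ F) x = 0 := by
      intro j hj1 hj2
      have h3 := norm_iteratedFDeriv_fderiv (𝕜 := ℝ) (f := F) (x := x) (n := j)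
      rwa [hj (j + 1) (by omega) (by omega), norm_zero, norm_eq_zero] at h3
    -- Mean value inequality. Intersecting with the closed ball of radius `‖y - x‖` about `x` keeps
    -- the set convex and bounds `‖z - x‖` by `‖y - x‖`, which gains one power.
    have h5 := Convex.norm_image_sub_le_of_norm_fderiv_le (𝕜 := ℝ) (f := F)
      (C := C * ‖y - x‖ ^ (k + 1)) (s := Metric.ball x₀ (min r r') ∩ Metric.closedBall x ‖y - x‖)
      (x := x) (y := y) (fun z hz => ?_) (fun z hz => ?_)
      ((convex_ball _ _).inter (convex_closedBall _ _)) ⟨hx, by simp⟩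
      ⟨hy, by simp [dist_eq_norm]⟩
    · rwa [mul_assoc, ← pow_succ] at h5
    · exact (hd (Metric.ball_subset_ball (min_le_right r r') hz.1)).differentiableAt
    · have h6 := h x hx1 z (Metric.ball_subset_ball (min_le_left r r') hz.1) h4
      rw [h1, sub_zero] at h6
      refine h6.trans ?_
      gcongr
      simpa [dist_eq_norm] using hz.2

/-- The image of the set of points where all derivatives up to the dimension vanish is null. -/
theorem volume_image_eq_zero_of_iteratedFDeriv_eq_zero {E : Type} [NormedAddCommGroup E]
    [NormedSpace ℝ E] [FiniteDimensional ℝ E] {f : E → ℝ} {S : Set E}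
    (hf : ∀ x ∈ S, AnalyticAt ℝ f x)
    (hS : ∀ x ∈ S, ∀ j, 1 ≤ j → j ≤ finrank ℝ E → iteratedFDeriv ℝ j f x = 0) :
    volume (f '' S) = 0 := by
  borelize E
  -- `s ↦ volume (f '' s)` is an outer measure, so its vanishing is a local question.
  refine measure_null_of_locally_null
    (μ := OuterMeasure.comap f (volume : Measure ℝ).toOuterMeasure) S fun x hx => ?_
  obtain ⟨C, hC, r, hr, h⟩ := (hf x hx).exists_norm_sub_le_pow (finrank ℝ E)
  refine ⟨S ∩ Metric.ball x r, inter_mem self_mem_nhdsWithin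
    (mem_nhdsWithin_of_mem_nhds (Metric.ball_mem_nhds x hr)), ?_⟩
  rw [OuterMeasure.comap_apply]
  -- The Taylor estimate makes `f` Hölder of exponent `dim E + 1` on this set. Hausdorff measure of
  -- that dimension vanishes on `E`, so the one-dimensional measure of the image is zero.
  have hH : HolderOnWith (⟨C, hC⟩ : ℝ≥0) ((finrank ℝ E + 1 : ℕ) : ℝ≥0) f (S ∩ Metric.ball x r) := by
    intro y hy z hz
    have h1 := h z hz.2 y hy.2 (hS z hz.1)
    have e1 : edist (f y) (f z) = ENNReal.ofReal ‖f y - f z‖ := by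
      rw [edist_dist, dist_eq_norm]
    have e2 : edist y z = ENNReal.ofReal ‖y - z‖ := by rw [edist_dist, dist_eq_norm]
    rw [e1, e2]
    refine (ENNReal.ofReal_le_ofReal h1).trans ?_
    rw [ENNReal.ofReal_mul hC, ENNReal.ofReal_pow (norm_nonneg _), NNReal.coe_natCast,
      ENNReal.rpow_natCast]
    gcongr
    rw [ENNReal.ofReal, Real.toNNReal_of_nonneg hC]
    exact le_rfl
  have h2 := hH.hausdorffMeasure_image_le (by positivity) zero_le_one
  rw [hausdorffMeasure_real, mul_one] at h2
  have h3 : μH[(((finrank ℝ E + 1 : ℕ) : ℝ≥0) : ℝ)] (S ∩ Metric.ball x r) = 0 := by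
    refine hausdorffMeasure_of_dimH_lt ?_
    refine (dimH_mono (subset_univ _)).trans_lt ?_
    rw [Real.dimH_univ_eq_finrank]
    push_cast
    exact ENNReal.lt_add_right (by simp) (by simp)
  rw [h3, mul_zero] at h2
  exact le_antisymm h2 zero_le

/-- Near a regular point of `w`, the critical points of `f` on a level set of `w` are, in a chart
of the level set, critical points of an analytic function of one variable less. -/
theorem exists_volume_image_eq_zero_of_hypersurface {E : Type} [NormedAddCommGroup E]
    [NormedSpace ℝ E] [FiniteDimensional ℝ E] {f w : E → ℝ} {S : Set E} {x : E} (hx : x ∈ S)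
    (hf : AnalyticAt ℝ f x) (hw : AnalyticAt ℝ w x) (hw' : fderiv ℝ w x ≠ 0)
    (hSf : ∀ y ∈ S, fderiv ℝ f y = 0) (hSw : ∀ y ∈ S, w y = 0)
    (ih : ∀ (g : (fderiv ℝ w x).ker → ℝ) (T : Set (fderiv ℝ w x).ker),
      (∀ y ∈ T, AnalyticAt ℝ g y) → (∀ y ∈ T, fderiv ℝ g y = 0) → volume (g '' T) = 0) :
    ∃ u ∈ 𝓝[S] x, volume (f '' u) = 0 := by
  set l := fderiv ℝ w x with hl
  obtain ⟨v, hv⟩ : ∃ v, l v = 1 := by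
    obtain ⟨v, hv⟩ : ∃ v, l v ≠ 0 := by
      by_contra! h
      exact hw' (ContinuousLinearMap.ext h)
    exact ⟨(l v)⁻¹ • v, by simp [hv]⟩
  -- As `l v = 1`, one has `l (Ψ y) = w y`: this local diffeomorphism, with derivative the identity
  -- at `x`, straightens the level set `w = 0` into `ker l`.
  set Ψ : E → E := fun y => y + (w y - l y) • v with hΨ
  have hΨa : AnalyticAt ℝ Ψ x := by
    refine analyticAt_id.add ((hw.sub (l.analyticAt x)).smul analyticAt_const)
  have hΨd : HasFDerivAt Ψ ((ContinuousLinearEquiv.refl ℝ E : E ≃L[ℝ] E) : E →L[ℝ] E) x := by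
    have h1 := (hasFDerivAt_id x).add
      ((hw.differentiableAt.hasFDerivAt.sub (l.hasFDerivAt (x := x))).smul_const v)
    have h2 : ContinuousLinearMap.id ℝ E + (fderiv ℝ w x - l).smulRight v
        = ((ContinuousLinearEquiv.refl ℝ E : E ≃L[ℝ] E) : E →L[ℝ] E) := by
      ext y
      simp [← hl]
    rw [← h2]
    exact h1
  have hc := hΨa.contDiffAt (n := ω)
  have hω : (ω : WithTop ℕ∞) ≠ 0 := by simp
  set θ := hc.localInverse hΨd hω with hθ
  have hθa : AnalyticAt ℝ θ (Ψ x) := (hc.to_localInverse hΨd hω).analyticAt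
  have hθx : θ (Ψ x) = x := hc.localInverse_apply_image hΨd hω
  have hinv : ∀ᶠ y in 𝓝 x, θ (Ψ y) = y :=
    (hc.hasStrictFDerivAt' hΨd hω).eventually_left_inverse
  have hθe : ∀ᶠ y in 𝓝 x, AnalyticAt ℝ θ (Ψ y) :=
    hΨa.continuousAt.eventually hθa.eventually_analyticAt
  have hker : ∀ y ∈ S, Ψ y ∈ l.ker := by
    intro y hy
    simp [hΨ, LinearMap.mem_ker, hSw y hy, hv]
  set u : Set E := {y | y ∈ S ∧ θ (Ψ y) = y ∧ AnalyticAt ℝ θ (Ψ y) ∧ AnalyticAt ℝ f y} with hu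
  refine ⟨u, ?_, ?_⟩
  · filter_upwards [self_mem_nhdsWithin, mem_nhdsWithin_of_mem_nhds hinv,
      mem_nhdsWithin_of_mem_nhds hθe, mem_nhdsWithin_of_mem_nhds hf.eventually_analyticAt]
      with y h1 h2 h3 h4 using ⟨h1, h2, h3, h4⟩
  · set g : l.ker → ℝ := fun z => f (θ z) with hg
    set T : Set l.ker := {z | ∃ y ∈ u, Ψ y = z} with hT
    have himg : f '' u ⊆ g '' T := by
      rintro _ ⟨y, hy, rfl⟩
      exact ⟨⟨Ψ y, hker y hy.1⟩, ⟨y, hy, rfl⟩, by simp [hg, hy.2.1]⟩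
    refine measure_mono_null himg (ih g T ?_ ?_)
    · rintro z ⟨y, hy, hyz⟩
      have h1 : AnalyticAt ℝ (f ∘ θ) (z : E) := by
        rw [← hyz]
        exact AnalyticAt.comp (by rw [hy.2.1]; exact hy.2.2.2) hy.2.2.1
      exact h1.comp (l.ker.subtypeL.analyticAt z)
    · rintro z ⟨y, hy, hyz⟩
      have h1 : HasFDerivAt f (0 : E →L[ℝ] ℝ) (θ z) := by
        rw [← hyz, hy.2.1, ← hSf y hy.1]
        exact hy.2.2.2.differentiableAt.hasFDerivAt
      have h2 : HasFDerivAt θ (fderiv ℝ θ z) (z : E) := by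
        rw [← hyz]
        exact hy.2.2.1.differentiableAt.hasFDerivAt
      have h3 := (h1.comp (z : E) h2).comp z (l.ker.subtypeL.hasFDerivAt (x := z))
      have h4 := h3.fderiv
      rw [ContinuousLinearMap.zero_comp, ContinuousLinearMap.zero_comp] at h4
      exact h4

/-- **Morse–Sard theorem** for real-valued analytic functions. -/
theorem volume_image_eq_zero_of_fderiv_eq_zero (n : ℕ) :
    ∀ (E : Type) [NormedAddCommGroup E] [NormedSpace ℝ E] [FiniteDimensional ℝ E],
      finrank ℝ E = n → ∀ (f : E → ℝ) (S : Set E), (∀ x ∈ S, AnalyticAt ℝ f x) →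
        (∀ x ∈ S, fderiv ℝ f x = 0) → volume (f '' S) = 0 := by
  induction n with
  | zero =>
    intro E _ _ _ hE f S hf hS
    exact volume_image_eq_zero_of_iteratedFDeriv_eq_zero hf (fun _ _ j h1 h2 => by omega)
  | succ n ih =>
    intro E _ _ _ hE f S hf hS
    set Z : ℕ → Set E := fun k => {x | ∀ j, 1 ≤ j → j ≤ k → iteratedFDeriv ℝ j f x = 0} with hZ
    -- A critical point is either flat up to order `n + 1`, the dimension, or has a first
    -- nonvanishing derivative, whose order `k + 2` is at least two.
    have hcover : S ⊆ (S ∩ Z (n + 1)) ∪ ⋃ k : ℕ, (S ∩ Z (k + 1)) \ Z (k + 2) := by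
      intro x hx
      by_cases hxn : ∀ k, x ∈ Z (k + 1)
      · exact Or.inl ⟨hx, hxn n⟩
      · push Not at hxn
        right
        classical
        have hs := Nat.find_spec hxn
        have hmin := fun m => Nat.find_min hxn (m := m)
        set k := Nat.find hxn with hk
        have hk0 : k ≠ 0 := by
          intro h0
          rw [h0] at hs
          apply hs
          intro j h1 h2
          obtain rfl : j = 1 := by omega
          have h3 := norm_iteratedFDeriv_fderiv (𝕜 := ℝ) (f := f) (x := x) (n := 0)
          rw [norm_iteratedFDeriv_zero, hS x hx, norm_zero] at h3
          exact norm_eq_zero.1 h3.symm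
        obtain ⟨k', hk'⟩ := Nat.exists_eq_succ_of_ne_zero hk0
        rw [mem_iUnion]
        refine ⟨k', ⟨hx, ?_⟩, ?_⟩
        · have := hmin k' (by omega)
          rwa [not_not] at this
        · rwa [hk'] at hs
    refine measure_mono_null (image_mono hcover) ?_
    rw [image_union, image_iUnion]
    refine measure_union_null ?_ (measure_iUnion_null fun k => ?_)
    · exact volume_image_eq_zero_of_iteratedFDeriv_eq_zero (fun x hx => hf x hx.1)
        (fun x hx => by rw [hE]; exact hx.2)
    · refine measure_null_of_locally_null
        (μ := OuterMeasure.comap f (volume : Measure ℝ).toOuterMeasure) _ fun x hx => ?_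
      simp only [OuterMeasure.comap_apply]
      obtain ⟨⟨hxS, hxZ⟩, hxZ'⟩ := hx
      have hD : iteratedFDeriv ℝ (k + 2) f x ≠ 0 := by
        intro h0
        refine hxZ' fun j h1 h2 => ?_
        rcases Nat.lt_or_ge j (k + 2) with h | h
        · exact hxZ j h1 (by omega)
        · obtain rfl : j = k + 2 := by omega
          exact h0
      have hDa : AnalyticAt ℝ (iteratedFDeriv ℝ (k + 1) f) x := by
        have h1 : ContDiffAt ℝ ω f x := AnalyticAt.contDiffAt (hf x hxS)
        exact (h1.iteratedFDeriv_right (m := ω) (i := k + 1) (by simp)).analyticAt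
      have hD1 : fderiv ℝ (iteratedFDeriv ℝ (k + 1) f) x ≠ 0 := by
        intro h0
        apply hD
        rw [iteratedFDeriv_succ_eq_comp_left, Function.comp_apply, h0]
        exact (continuousMultilinearCurryLeftEquiv ℝ (fun _ : Fin (k + 2) => E) ℝ).symm.map_zero
      -- Evaluating the derivative of order `k + 1` at suitable vectors `m` gives a scalar function
      -- that vanishes on the piece but has nonzero differential at `x`. The piece thus lies in a
      -- hypersurface near `x`, and the induction on dimension applies.
      obtain ⟨h, hh⟩ : ∃ h, fderiv ℝ (iteratedFDeriv ℝ (k + 1) f) x h ≠ 0 := by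
        by_contra! h
        exact hD1 (ContinuousLinearMap.ext h)
      obtain ⟨m, hm⟩ : ∃ m, fderiv ℝ (iteratedFDeriv ℝ (k + 1) f) x h m ≠ 0 := by
        by_contra! h'
        exact hh (ContinuousMultilinearMap.ext h')
      set A := ContinuousMultilinearMap.apply ℝ (fun _ : Fin (k + 1) => E) ℝ m with hA
      have hwa : AnalyticAt ℝ (fun y => iteratedFDeriv ℝ (k + 1) f y m) x :=
        (A.analyticAt _).comp hDa
      have hwd : fderiv ℝ (fun y => iteratedFDeriv ℝ (k + 1) f y m) x ≠ 0 := by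
        have h1 : HasFDerivAt (fun y => iteratedFDeriv ℝ (k + 1) f y m)
            (A.comp (fderiv ℝ (iteratedFDeriv ℝ (k + 1) f) x)) x :=
          A.hasFDerivAt.comp x hDa.differentiableAt.hasFDerivAt
        rw [h1.fderiv]
        intro h0
        exact hm (by simpa [hA] using congrArg (fun B => B h) h0)
      refine exists_volume_image_eq_zero_of_hypersurface ⟨⟨hxS, hxZ⟩, hxZ'⟩ (hf x hxS) hwa hwd
        (fun y hy => hS y hy.1.1) (fun y hy => ?_) (fun g T hg hT => ih _ ?_ g T hg hT)
      · rw [hy.1.2 (k + 1) (by omega) le_rfl]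
        rfl
      · set l := (fderiv ℝ (fun y => iteratedFDeriv ℝ (k + 1) f y m) x).toLinearMap with hl
        have h1 := l.finrank_range_add_finrank_ker
        have h2 : LinearMap.range l = ⊤ := by
          refine LinearMap.range_eq_top.2 (LinearMap.surjective fun h0 => hwd ?_)
          ext y
          exact congrArg (fun B => B y) h0
        rw [h2, finrank_top, finrank_self, hE] at h1
        have h3 : finrank ℝ (LinearMap.ker l) = n := by omega
        exact h3

end MorseSard

/-! ### Lyapunov functions and connectedness for chain transitive sets. -/

section ChainTransitive

variable {M : Type*} [MetricSpace M] {Φ : Flow ℝ≥0 M} {Λ : Set M}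

theorem IsInternallyChainTransitive.flow_mem (hΛ : IsInternallyChainTransitive Φ Λ) {x : M}
    (hx : x ∈ Λ) (t : ℝ≥0) : Φ t x ∈ Λ :=
  (hΛ.2.2.1 t).subset (mem_image_of_mem _ hx)

/-- A continuous strict Lyapunov function whose values at the equilibria are negligible forces an
internally chain transitive set to consist of equilibria. -/
theorem IsInternallyChainTransitive.subset_of_lyapunov (hΛ : IsInternallyChainTransitive Φ Λ)
    {V : M → ℝ} {S : Set M} (hV : ContinuousOn V Λ) (hmono : ∀ x ∈ Λ, ∀ t, V x ≤ V (Φ t x))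
    (hstrict : ∀ x ∈ Λ, x ∉ S → V x < V (Φ 1 x)) (hnull : volume (V '' (Λ ∩ S)) = 0) : Λ ⊆ S := by
  intro x hx
  by_contra hxS
  have hflow := fun {y} => hΛ.flow_mem (x := y)
  have hcomp := hΛ.2.1
  have hlt := hstrict x hx hxS
  -- A null set cannot fill an interval. At this level `c`, time one pushes `{V ≥ c}` strictly above
  -- `c`, even at equilibria.
  obtain ⟨c, ⟨hc1, hc2⟩, hcn⟩ : ∃ c ∈ Ioo (V x) (V (Φ 1 x)), c ∉ V '' (Λ ∩ S) := by
    by_contra! h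
    have h1 := measure_mono_null (μ := volume) (fun c hc => h c hc) hnull
    rw [Real.volume_Ioo, ENNReal.ofReal_eq_zero] at h1
    linarith
  have hstep : ∀ y ∈ Λ, c ≤ V y → c < V (Φ 1 y) := by
    intro y hy hcy
    by_cases hyS : y ∈ S
    · refine (lt_of_le_of_ne hcy fun h => hcn ⟨y, ⟨hy, hyS⟩, h.symm⟩).trans_le (hmono y hy 1)
    · exact hcy.trans_lt (hstrict y hy hyS)
  have hcont1 : ContinuousOn (fun y => V (Φ 1 y)) Λ :=
    hV.comp (Φ.continuous continuous_const continuous_id).continuousOn fun y hy => hflow hy 1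
  have hAc : IsCompact (Λ ∩ {y | c ≤ V y}) := by
    have := hV.preimage_isClosed_of_isClosed hcomp.isClosed (isClosed_Ici (a := c))
    exact hcomp.of_isClosed_subset this inter_subset_left
  obtain ⟨z, hz, hzmin⟩ := hAc.exists_isMinOn
    ⟨Φ 1 x, hflow hx 1, hc2.le⟩ (hcont1.mono inter_subset_left)
  -- The first term is the least gain over the compact set `{V ≥ c}` in `Λ` and absorbs every jump;
  -- the second absorbs the initial error at `Φ 1 x`. A chain from `Φ 1 x` thus stays above `c` and
  -- cannot end at `x`.
  set ε := min (V (Φ 1 z) - c) (V (Φ 1 x) - c) with hε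
  have hε0 : 0 < ε := lt_min (sub_pos.2 (hstep z hz.1 hz.2)) (sub_pos.2 hc2)
  obtain ⟨δ, hδ, hunif⟩ := Metric.uniformContinuousOn_iff.1
    (hcomp.uniformContinuousOn_of_continuous hV) ε hε0
  obtain ⟨k, y, t, hk, hyΛ, ht, hy0, hyj, hyk⟩ := hΛ.2.2.2 (Φ 1 x) (hflow hx 1) x hx δ hδ 1 one_pos
  have hall : ∀ j, j ≤ k → c ≤ V (y j) := by
    intro j
    induction j with
    | zero =>
      intro _
      have h1 := hunif (y 0) (hyΛ 0 (Nat.zero_le _)) (Φ 1 x) (hflow hx 1) hy0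
      rw [Real.dist_eq] at h1
      have h2 := (abs_lt.1 h1).1
      have h3 := min_le_right (V (Φ 1 z) - c) (V (Φ 1 x) - c)
      linarith
    | succ j ih =>
      intro hj
      have hjk : j < k := hj
      have hyjΛ := hyΛ j hjk.le
      have h1 := hunif _ (hflow hyjΛ (t j)) _ (hyΛ (j + 1) hj) (hyj j hjk)
      rw [Real.dist_eq] at h1
      have h2 := (abs_lt.1 h1).2
      have h3 := min_le_left (V (Φ 1 z) - c) (V (Φ 1 x) - c)
      have h4 : V (Φ 1 z) ≤ V (Φ 1 (y j)) := hzmin ⟨hyjΛ, ih hjk.le⟩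
      have h5 : V (Φ 1 (y j)) ≤ V (Φ (t j) (y j)) := by
        have h6 := hmono (Φ 1 (y j)) (hflow hyjΛ 1) (t j - 1)
        rwa [← Φ.map_add, tsub_add_cancel_of_le (ht j hjk)] at h6
      linarith
  have := hall k le_rfl
  rw [hyk] at this
  linarith

/-- An internally chain transitive set of rest points is connected. -/
theorem IsInternallyChainTransitive.isPreconnected (hΛ : IsInternallyChainTransitive Φ Λ)
    (hrest : ∀ x ∈ Λ, ∀ t, Φ t x = x) : IsPreconnected Λ := by
  rw [isPreconnected_closed_iff]
  intro A B hA hB hAB ⟨a, haΛ, haA⟩ ⟨b, hbΛ, hbB⟩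
  by_contra hne
  have hdisj : Disjoint (Λ ∩ A) (Λ ∩ B) := by
    rw [disjoint_left]
    exact fun x hx hx' => hne ⟨x, hx.1, hx.2, hx'.2⟩
  -- Two disjoint compact pieces have disjoint `δ`-thickenings, and a chain of rest points moves
  -- only by jumps shorter than `δ`.
  obtain ⟨δ, hδ, hdist⟩ := hdisj.exists_thickenings (hΛ.2.1.inter_right hA)
    (hΛ.2.1.inter_right hB).isClosed
  have hfar : ∀ x ∈ Λ ∩ A, ∀ y ∈ Λ, dist x y < δ → y ∈ Λ ∩ A := by
    intro x hx y hy hxy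
    refine ⟨hy, (hAB hy).resolve_right fun hyB => ?_⟩
    exact disjoint_left.1 hdist (Metric.mem_thickening_iff.2 ⟨x, hx, by rwa [dist_comm]⟩)
      (Metric.self_subset_thickening hδ _ ⟨hy, hyB⟩)
  obtain ⟨k, y, t, hk, hyΛ, ht, hy0, hyj, hyk⟩ := hΛ.2.2.2 a haΛ b hbΛ δ hδ 1 one_pos
  have hall : ∀ j, j ≤ k → y j ∈ Λ ∩ A := by
    intro j
    induction j with
    | zero =>
      exact fun _ => hfar a ⟨haΛ, haA⟩ _ (hyΛ 0 (Nat.zero_le _)) (by rwa [dist_comm])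
    | succ j ih =>
      intro hj
      refine hfar (y j) (ih (by omega)) _ (hyΛ _ hj) ?_
      have := hyj j hj
      rwa [hrest _ (hyΛ j (by omega))] at this
  exact hne ⟨b, hbΛ, hyk ▸ (hall k le_rfl).2, hbB⟩

end ChainTransitive

/-! ### Gibbs measures: analyticity and derivatives of means and free energy. -/

section Gibbs

open scoped ContDiff

variable {B : Type*} [TopologicalSpace B] [CompactSpace B]

/-- The pointwise exponential of a continuous function. -/
def ContinuousMap.pexp (y : C(B, ℝ)) : C(B, ℝ) := ⟨fun b => Real.exp (y b), by fun_prop⟩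

@[simp]
theorem ContinuousMap.pexp_apply (y : C(B, ℝ)) (b : B) : y.pexp b = Real.exp (y b) := rfl

/-- Point evaluations are continuous algebra homomorphisms, so they commute with the Banach algebra
exponential. Analyticity and the derivative of `pexp` are inherited from the latter. -/
theorem ContinuousMap.pexp_eq_exp :
    (ContinuousMap.pexp : C(B, ℝ) → C(B, ℝ)) = NormedSpace.exp := by
  let : NormedAlgebra ℚ C(B, ℝ) := NormedAlgebra.restrictScalars ℚ ℝ C(B, ℝ)
  ext y b
  have h := NormedSpace.map_exp (ContinuousMap.evalAlgHom ℝ ℝ b : C(B, ℝ) →ₐ[ℝ] ℝ)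
    (continuous_eval_const b) y
  rw [ContinuousMap.pexp_apply, Real.exp_eq_exp_ℝ]
  exact h.symm

theorem ContinuousMap.contDiff_pexp : ContDiff ℝ ω (ContinuousMap.pexp : C(B, ℝ) → C(B, ℝ)) := by
  rw [ContinuousMap.pexp_eq_exp, contDiff_iff_contDiffAt]
  exact fun y => (NormedSpace.exp_analytic (𝕂 := ℝ) y).contDiffAt

theorem ContinuousMap.hasFDerivAt_pexp (y : C(B, ℝ)) :
    HasFDerivAt (ContinuousMap.pexp : C(B, ℝ) → C(B, ℝ))
      (y.pexp • (1 : C(B, ℝ) →L[ℝ] C(B, ℝ))) y := by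
  rw [ContinuousMap.pexp_eq_exp]
  exact hasFDerivAt_exp

variable [MeasurableSpace B] [BorelSpace B]
variable {Y : Type*} [NormedAddCommGroup Y] [NormedSpace ℝ Y]

theorem ContinuousMap.integrable (μ : Measure B) [IsFiniteMeasure μ] (f : C(B, ℝ)) :
    Integrable f μ :=
  f.continuous.integrable_of_hasCompactSupport (HasCompactSupport.of_compactSpace _)

theorem integrable_continuousMap_smul {μ : Measure B} {H : B → Y} (hH : Integrable H μ)
    (f : C(B, ℝ)) : Integrable (fun b => f b • H b) μ :=
  hH.bdd_smul ‖f‖ f.continuous.measurable.aestronglyMeasurable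
    (ae_of_all _ fun b => f.norm_coe_le_norm b)

/-- The continuous linear map `f ↦ ∫ f • H`. -/
def weightedIntegral (μ : Measure B) (H : B → Y) (hH : Integrable H μ) : C(B, ℝ) →L[ℝ] Y :=
  LinearMap.mkContinuous
    { toFun := fun f => ∫ b, f b • H b ∂μ
      map_add' := fun f g => by
        simp only [ContinuousMap.add_apply, add_smul]
        exact integral_add (integrable_continuousMap_smul hH f) (integrable_continuousMap_smul hH g)
      map_smul' := fun c f => by
        simp only [ContinuousMap.smul_apply, smul_assoc, RingHom.id_apply]
        exact integral_smul c _ }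
    (∫ b, ‖H b‖ ∂μ) fun f => by
      refine (norm_integral_le_integral_norm _).trans ?_
      rw [mul_comm, ← integral_const_mul]
      refine integral_mono (integrable_continuousMap_smul hH f).norm (hH.norm.const_mul _)
        fun b => ?_
      dsimp only
      rw [norm_smul]
      gcongr
      exact f.norm_coe_le_norm b

theorem weightedIntegral_apply {μ : Measure B} {H : B → Y} (hH : Integrable H μ) (f : C(B, ℝ)) :
    weightedIntegral μ H hH f = ∫ b, f b • H b ∂μ := rfl

variable {μ : Measure B} [IsFiniteMeasure μ] [NeZero μ]

theorem isProbabilityMeasure_tilted_continuousMap (y : C(B, ℝ)) :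
    IsProbabilityMeasure (μ.tilted y) :=
  isProbabilityMeasure_tilted (y.pexp.integrable μ)

theorem integrable_tilted_continuousMap {H : B → Y} (hH : Integrable H μ) (y : C(B, ℝ)) :
    Integrable H (μ.tilted y) :=
  (integrable_tilted_iff (y.pexp.integrable μ) H).2 (integrable_continuousMap_smul hH y.pexp)

variable (μ) in
/-- The partition function `∫ exp y`, as a function of `y`. -/
def partitionFunction (y : C(B, ℝ)) : ℝ := weightedIntegral μ (fun _ => (1 : ℝ)) (integrable_const 1) y.pexp

theorem partitionFunction_eq (y : C(B, ℝ)) :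
    partitionFunction μ y = ∫ b, Real.exp (y b) ∂μ := by
  simp [partitionFunction, weightedIntegral_apply]

theorem partitionFunction_pos (y : C(B, ℝ)) : 0 < partitionFunction μ y := by
  rw [partitionFunction_eq]
  exact integral_exp_pos (y.pexp.integrable μ)

/-- A Gibbs mean is a quotient of continuous linear maps applied to `y.pexp`; all smoothness
statements reduce to this form. -/
theorem integral_tilted_continuousMap (H : B → Y) (y : C(B, ℝ)) :
    ∫ b, H b ∂(μ.tilted y) = (partitionFunction μ y)⁻¹ • ∫ b, y.pexp b • H b ∂μ := by
  rw [integral_tilted, ← partitionFunction_eq, ← integral_smul]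
  congr with b
  rw [smul_smul, div_eq_inv_mul]
  rfl

theorem contDiff_partitionFunction : ContDiff ℝ ω (partitionFunction μ) :=
  (ContinuousLinearMap.contDiff _).comp ContinuousMap.contDiff_pexp

theorem hasFDerivAt_partitionFunction (y : C(B, ℝ)) :
    HasFDerivAt (partitionFunction μ)
      (partitionFunction μ y • weightedIntegral (μ.tilted y) (fun _ => (1 : ℝ))
        (integrable_tilted_continuousMap (integrable_const 1) y)) y := by
  have h := (weightedIntegral μ (fun _ => (1 : ℝ)) (integrable_const 1)).hasFDerivAt.comp y
    (ContinuousMap.hasFDerivAt_pexp y)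
  refine h.congr_fderiv ?_
  ext k
  have h1 := integral_tilted_continuousMap (μ := μ) k y
  simp only [smul_eq_mul] at h1
  simp [weightedIntegral_apply, h1, (partitionFunction_pos (μ := μ) y).ne']

theorem contDiff_integral_tilted {H : B → Y} (hH : Integrable H μ) :
    ContDiff ℝ ω fun y : C(B, ℝ) => ∫ b, H b ∂(μ.tilted y) := by
  simp_rw [integral_tilted_continuousMap]
  exact (contDiff_partitionFunction.inv fun y => (partitionFunction_pos y).ne').smul
    ((weightedIntegral μ H hH).contDiff.comp ContinuousMap.contDiff_pexp)

/-- By the quotient rule, the derivative in direction `k` is the covariance of `k` and `H` under the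
Gibbs measure. -/
theorem hasFDerivAt_integral_tilted {H : B → Y} (hH : Integrable H μ) (y : C(B, ℝ)) :
    HasFDerivAt (fun y : C(B, ℝ) => ∫ b, H b ∂(μ.tilted y))
      (weightedIntegral (μ.tilted y) H (integrable_tilted_continuousMap hH y) -
        (weightedIntegral (μ.tilted y) (fun _ => (1 : ℝ))
          (integrable_tilted_continuousMap (integrable_const 1) y)).smulRight
            (∫ b, H b ∂(μ.tilted y))) y := by
  have hZ := (partitionFunction_pos (μ := μ) y).ne'
  have h1 := ((hasDerivAt_inv hZ).comp_hasFDerivAt y (hasFDerivAt_partitionFunction y)).smul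
    ((weightedIntegral μ H hH).hasFDerivAt.comp y (ContinuousMap.hasFDerivAt_pexp y))
  have h2 : (fun y : C(B, ℝ) => ∫ b, H b ∂(μ.tilted y)) = ((Inv.inv ∘ partitionFunction μ) •
      (⇑(weightedIntegral μ H hH) ∘ ContinuousMap.pexp)) :=
    funext fun y => integral_tilted_continuousMap H y
  rw [h2]
  refine h1.congr_fderiv ?_
  ext k
  simp only [sub_apply, ContinuousLinearMap.smulRight_apply,
    add_apply, smul_apply, ContinuousLinearMap.comp_apply,
    weightedIntegral_apply, Function.comp_apply, one_apply_eq_self,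
    integral_tilted_continuousMap H, integral_tilted_continuousMap (fun b => k b • H b), smul_smul,
    smul_eq_mul, mul_one, ContinuousMap.mul_apply]
  rw [sub_eq_add_neg, ← neg_smul]
  congr 2
  field_simp

/-- Here the integrand moves with the measure, so the numerator is rewritten as a fixed linear
functional of `y * y.pexp`. -/
theorem integral_tilted_self (y : C(B, ℝ)) : ∫ b, y b ∂(μ.tilted y) = (partitionFunction μ y)⁻¹ *
    weightedIntegral μ (fun _ => (1 : ℝ)) (integrable_const 1) (y * y.pexp) := by
  rw [integral_tilted_continuousMap, weightedIntegral_apply]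
  simp [mul_comm]

theorem contDiff_integral_tilted_self :
    ContDiff ℝ ω fun y : C(B, ℝ) => ∫ b, y b ∂(μ.tilted y) := by
  simp_rw [integral_tilted_self]
  exact (contDiff_partitionFunction.inv fun y => (partitionFunction_pos y).ne').mul
    ((ContinuousLinearMap.contDiff _).comp (contDiff_id.mul ContinuousMap.contDiff_pexp))

theorem hasFDerivAt_integral_tilted_self (y : C(B, ℝ)) :
    HasFDerivAt (fun y : C(B, ℝ) => ∫ b, y b ∂(μ.tilted y))
      (weightedIntegral (μ.tilted y) y (integrable_tilted_continuousMap (y.integrable μ) y) +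
        (1 - ∫ b, y b ∂(μ.tilted y)) • weightedIntegral (μ.tilted y) (fun _ => (1 : ℝ))
          (integrable_tilted_continuousMap (integrable_const 1) y)) y := by
  have hZ := (partitionFunction_pos (μ := μ) y).ne'
  have h1 := ((hasDerivAt_inv hZ).comp_hasFDerivAt y (hasFDerivAt_partitionFunction y)).mul
    ((weightedIntegral μ (fun _ => (1 : ℝ)) (integrable_const 1)).hasFDerivAt.comp y
      ((hasFDerivAt_id y).mul (ContinuousMap.hasFDerivAt_pexp y)))
  have h2 : (fun y : C(B, ℝ) => ∫ b, y b ∂(μ.tilted y)) = ((Inv.inv ∘ partitionFunction μ) *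
      (⇑(weightedIntegral μ (fun _ => (1 : ℝ)) (integrable_const 1)) ∘
        (id * ContinuousMap.pexp))) :=
    funext fun y => integral_tilted_self y
  rw [h2]
  refine h1.congr_fderiv ?_
  ext k
  simp only [add_apply, smul_apply, ContinuousLinearMap.comp_apply, weightedIntegral_apply,
    Function.comp_apply, one_apply_eq_self, smul_eq_mul, mul_one, ContinuousMap.mul_apply,
    ContinuousLinearMap.id_apply, id, ContinuousMap.add_apply, Pi.mul_apply,
    integral_tilted_continuousMap y, integral_tilted_continuousMap k,
    integral_tilted_continuousMap (fun b => k b * y b)]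
  have e0 : ∫ b, (y b * (y.pexp b * k b) + y.pexp b * k b) ∂μ
      = ∫ b, y b * (y.pexp b * k b) ∂μ + ∫ b, y.pexp b * k b ∂μ :=
    integral_add (((y * (y.pexp * k) : C(B, ℝ))).integrable μ)
      (((y.pexp * k : C(B, ℝ))).integrable μ)
  have e1 : ∫ b, y b * (y.pexp b * k b) ∂μ = ∫ b, y.pexp b * (k b * y b) ∂μ := by
    congr with b; ring
  have e2 : ∫ b, y b * y.pexp b ∂μ = ∫ b, y.pexp b * y b ∂μ := by
    congr with b; ring
  rw [e0, e1, e2]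
  field_simp
  ring

variable (μ) in
/-- The free energy of the Gibbs measure with density proportional to `exp y`: its mean payoff `ψ`
plus its entropy. -/
def freeEnergy (ψ y : C(B, ℝ)) : ℝ :=
  ∫ b, ψ b ∂(μ.tilted y) - ∫ b, y b ∂(μ.tilted y) + Real.log (partitionFunction μ y)

theorem contDiff_freeEnergy (ψ : C(B, ℝ)) : ContDiff ℝ ω (freeEnergy μ ψ) :=
  ((contDiff_integral_tilted (ψ.integrable μ)).sub contDiff_integral_tilted_self).add
    ((contDiff_partitionFunction (μ := μ)).log fun y => (partitionFunction_pos (μ := μ) y).ne')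

/-- The derivative of the free energy at `y` in the direction `k` is the covariance of `ψ - y`
and `k` under the Gibbs measure. -/
theorem fderiv_freeEnergy (ψ y k : C(B, ℝ)) :
    fderiv ℝ (freeEnergy μ ψ) y k = ∫ b, k b * (ψ b - y b) ∂(μ.tilted y) -
      (∫ b, k b ∂(μ.tilted y)) * ∫ b, (ψ b - y b) ∂(μ.tilted y) := by
  have := isProbabilityMeasure_tilted_continuousMap (μ := μ) y
  have hZ := (partitionFunction_pos (μ := μ) y).ne'
  -- The extra mean of `k` from differentiating the integrand `y` cancels the derivative of `log Z`,
  -- leaving only covariances.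
  have h := ((hasFDerivAt_integral_tilted (ψ.integrable μ) y).sub
    (hasFDerivAt_integral_tilted_self (μ := μ) y)).add ((hasFDerivAt_partitionFunction y).log hZ)
  have h' : HasFDerivAt (freeEnergy μ ψ) _ y := h
  rw [h'.fderiv]
  simp only [add_apply, sub_apply, smul_apply, weightedIntegral_apply, smul_eq_mul, mul_one,
    ContinuousLinearMap.smulRight_apply]
  have e : ∀ b, k b * (ψ b - y b) = k b * ψ b - k b * y b := fun b => mul_sub _ _ _
  simp_rw [e]
  have e1 : ∫ b, (k b * ψ b - k b * y b) ∂(μ.tilted y)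
      = ∫ b, k b * ψ b ∂(μ.tilted y) - ∫ b, k b * y b ∂(μ.tilted y) :=
    integral_sub ((k * ψ).integrable _) ((k * y).integrable _)
  rw [e1, integral_sub (ψ.integrable _) (y.integrable _)]
  field_simp
  ring

end Gibbs

/-! ### Independent Gibbs strategies and their joint free energy. -/

section Product

open scoped ContDiff

variable {ι : Type} [Fintype ι] [DecidableEq ι] {A : ι → Type} [∀ i, TopologicalSpace (A i)]
  [∀ i, CompactSpace (A i)] [∀ i, SecondCountableTopology (A i)] [∀ i, MeasurableSpace (A i)]
  [∀ i, BorelSpace (A i)]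

variable (A) in
/-- The continuous linear map that sends a family `v` to the function `b ↦ ∑ i, v i (b i)`. -/
def sumCoord : (∀ i, C(A i, ℝ)) →L[ℝ] C(∀ i, A i, ℝ) :=
  ∑ i, (⟨(ContinuousMap.compRightAlgHom ℝ ℝ
      ⟨fun b : ∀ i, A i => b i, continuous_apply i⟩).toLinearMap,
    ContinuousMap.continuous_precomp _⟩ : C(A i, ℝ) →L[ℝ] C(∀ i, A i, ℝ)).comp
      (ContinuousLinearMap.proj i)

theorem sumCoord_apply (v : ∀ i, C(A i, ℝ)) (b : ∀ i, A i) : sumCoord A v b = ∑ i, v i (b i) := by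
  rw [sumCoord, sum_apply, ContinuousMap.coe_sum, Finset.sum_apply]
  rfl

theorem norm_sumCoord_apply_le (v : ∀ i, C(A i, ℝ)) :
    ‖sumCoord A v‖ ≤ Fintype.card ι * ‖v‖ := by
  rw [ContinuousMap.norm_le _ (by positivity)]
  intro b
  rw [sumCoord_apply]
  refine (norm_sum_le _ _).trans ?_
  refine (Finset.sum_le_card_nsmul _ _ ‖v‖ fun i _ => ?_).trans (by simp)
  exact ((v i).norm_coe_le_norm _).trans (norm_le_pi_norm v i)

theorem sumCoord_update (v : ∀ i, C(A i, ℝ)) (b : ∀ i, A i) (i : ι) (x : A i) :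
    sumCoord A v (Function.update b i x) = v i x + (sumCoord A v b - v i (b i)) := by
  rw [sumCoord_apply, sumCoord_apply, ← Finset.add_sum_erase _ _ (Finset.mem_univ i),
    ← Finset.add_sum_erase _ (fun j => v j (b j)) (Finset.mem_univ i), Function.update_self]
  rw [Finset.sum_congr rfl (g := fun j => v j (b j)) fun j hj => by
    rw [Function.update_of_ne (Finset.ne_of_mem_erase hj)]]
  ring

section Update

variable {ν : ∀ i, Measure (A i)} [∀ i, IsProbabilityMeasure (ν i)]

/-- Resampling one coordinate does not change a product probability measure. -/
theorem map_update_prod_pi (i : ι) :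
    ((ν i).prod (Measure.pi ν)).map (fun p : A i × (∀ j, A j) => Function.update p.2 i p.1)
      = Measure.pi ν := by
  symm
  refine Measure.pi_eq fun s hs => ?_
  have hm : Measurable fun p : A i × (∀ j, A j) => Function.update p.2 i p.1 :=
    (Continuous.update continuous_snd i continuous_fst).measurable
  rw [Measure.map_apply hm (MeasurableSet.univ_pi hs)]
  have h1 : (fun p : A i × (∀ j, A j) => Function.update p.2 i p.1) ⁻¹' (univ.pi s)
      = (s i) ×ˢ (univ.pi (Function.update s i univ)) := by
    ext p
    simp only [mem_preimage, mem_univ_pi, mem_prod]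
    constructor
    · intro h
      refine ⟨by simpa using h i, fun j => ?_⟩
      by_cases hj : j = i
      · subst hj; simp
      · simpa [hj] using h j
    · rintro ⟨h1, h2⟩ j
      by_cases hj : j = i
      · subst hj; simpa using h1
      · simpa [hj] using h2 j
  rw [h1, Measure.prod_prod, Measure.pi_pi, ← Finset.mul_prod_erase _ _ (Finset.mem_univ i),
    ← Finset.mul_prod_erase _ (fun j => ν j (s j)) (Finset.mem_univ i), Function.update_self,
    measure_univ, one_mul]
  congr 1
  exact Finset.prod_congr rfl fun j hj => by
    rw [Function.update_of_ne (Finset.ne_of_mem_erase hj)]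

theorem integral_pi_eq_integral_update (i : ι) (f : C(∀ i, A i, ℝ)) :
    ∫ b, f b ∂(Measure.pi ν) = ∫ x, ∫ b, f (Function.update b i x) ∂(Measure.pi ν) ∂(ν i) := by
  have hc : Continuous fun p : A i × (∀ j, A j) => Function.update p.2 i p.1 :=
    Continuous.update continuous_snd i continuous_fst
  conv_lhs => rw [← map_update_prod_pi i]
  rw [integral_map hc.aemeasurable f.continuous.measurable.aestronglyMeasurable]
  exact integral_prod _ ((f.comp ⟨_, hc⟩).integrable _)

end Update

variable (μ : ∀ i, Measure (A i)) [∀ i, IsFiniteMeasure (μ i)] [∀ i, NeZero (μ i)]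

/-- The exponential of a sum of coordinate functions is a product. Independent Gibbs strategies are
therefore one Gibbs measure on joint actions, with log-density linear in `v`. -/
theorem pi_tilted (v : ∀ i, C(A i, ℝ)) :
    Measure.pi (fun i => (μ i).tilted (v i)) = (Measure.pi μ).tilted (sumCoord A v) := by
  have := fun i => isProbabilityMeasure_tilted_continuousMap (μ := μ i) (v i)
  refine Measure.pi_eq fun s hs => ?_
  have hZ : ∀ t : ∀ i, Set (A i), (∀ i, MeasurableSet (t i)) →
      ∫ b in univ.pi t, Real.exp (sumCoord A v b) ∂(Measure.pi μ)
      = ∏ i, ∫ x in t i, Real.exp (v i x) ∂(μ i) := by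
    intro t ht
    rw [Measure.restrict_pi_pi]
    simp_rw [sumCoord_apply, Real.exp_sum]
    exact integral_fintype_prod_eq_prod (𝕜 := ℝ) (fun i x => Real.exp (v i x))
  have hZ' : ∫ b, Real.exp (sumCoord A v b) ∂(Measure.pi μ) = ∏ i, ∫ x, Real.exp (v i x) ∂(μ i) := by
    simpa using hZ (fun _ => univ) fun _ => MeasurableSet.univ
  rw [tilted_apply_eq_ofReal_integral _ _, integral_div, hZ s hs, hZ', ← Finset.prod_div_distrib,
    ENNReal.ofReal_prod_of_nonneg]
  · refine Finset.prod_congr rfl fun i _ => ?_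
    rw [tilted_apply_eq_ofReal_integral, integral_div]
  · intro i _
    exact div_nonneg (integral_nonneg fun _ => (Real.exp_pos _).le)
      (integral_nonneg fun _ => (Real.exp_pos _).le)

instance : NeZero (Measure.pi μ) := by
  refine ⟨fun h => ?_⟩
  have h1 := Measure.pi_univ μ
  rw [h, Measure.coe_zero, Pi.zero_apply] at h1
  exact Finset.prod_ne_zero_iff.2 (fun i _ => by simpa using NeZero.ne (μ i)) h1.symm

/-- The payoffs `ψ (x, b₋ᵢ)` of the actions `x` against `b`, as a continuous function of `x`. -/
def payoffAgainst (ψ : C(∀ i, A i, ℝ)) (i : ι) : C(∀ i, A i, C(A i, ℝ)) :=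
  ContinuousMap.curry ⟨fun p : (∀ j, A j) × A i => ψ (Function.update p.1 i p.2),
    ψ.continuous.comp (Continuous.update continuous_fst i continuous_snd)⟩

theorem integrable_payoffAgainst (ψ : C(∀ i, A i, ℝ)) (i : ι) (ρ : Measure (∀ i, A i))
    [IsFiniteMeasure ρ] : Integrable (payoffAgainst ψ i) ρ :=
  (payoffAgainst ψ i).continuous.integrable_of_hasCompactSupport
    (HasCompactSupport.of_compactSpace _)

/-- The expected payoff of each action of player `i` when the strategies of the players are the
Gibbs measures with log-densities `v`. -/
def gibbsPayoff (ψ : C(∀ i, A i, ℝ)) (v : ∀ i, C(A i, ℝ)) (i : ι) : C(A i, ℝ) :=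
  ∫ b, payoffAgainst ψ i b ∂((Measure.pi μ).tilted (sumCoord A v))

theorem integral_payoffAgainst_apply (ψ : C(∀ i, A i, ℝ)) (i : ι) (ρ : Measure (∀ i, A i))
    [IsFiniteMeasure ρ] (x : A i) :
    (∫ b, payoffAgainst ψ i b ∂ρ) x = ∫ b, ψ (Function.update b i x) ∂ρ :=
  ((ContinuousMap.evalCLM ℝ x).integral_comp_comm (integrable_payoffAgainst ψ i ρ)).symm

variable {μ}

theorem contDiff_gibbsPayoff (ψ : C(∀ i, A i, ℝ)) : ContDiff ℝ ω (gibbsPayoff μ ψ) :=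
  contDiff_pi.2 fun i => (contDiff_integral_tilted (integrable_payoffAgainst ψ i _)).comp
    (sumCoord A).contDiff

/-- Covariances with a function of one coordinate are computed by averaging out the other
coordinates. -/
theorem covariance_coordinate (ψ : C(∀ i, A i, ℝ)) (v : ∀ i, C(A i, ℝ)) (i : ι) (h : C(A i, ℝ)) :
    ∫ b, h (b i) * (ψ b - sumCoord A v b) ∂((Measure.pi μ).tilted (sumCoord A v)) -
      (∫ b, h (b i) ∂((Measure.pi μ).tilted (sumCoord A v))) *
        ∫ b, (ψ b - sumCoord A v b) ∂((Measure.pi μ).tilted (sumCoord A v)) =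
    ∫ x, h x * (gibbsPayoff μ ψ v i x - v i x) ∂((μ i).tilted (v i)) -
      (∫ x, h x ∂((μ i).tilted (v i))) *
        ∫ x, (gibbsPayoff μ ψ v i x - v i x) ∂((μ i).tilted (v i)) := by
  have hp := fun i => isProbabilityMeasure_tilted_continuousMap (μ := μ i) (v i)
  have hp' := isProbabilityMeasure_tilted_continuousMap (μ := Measure.pi μ) (sumCoord A v)
  set Q := (Measure.pi μ).tilted (sumCoord A v) with hQ
  have hpt : Measure.pi (fun i => (μ i).tilted (v i)) = Q := pi_tilted μ v
  set hi : C(∀ i, A i, ℝ) := h.comp ⟨fun b => b i, continuous_apply i⟩ with hhi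
  set vi : C(∀ i, A i, ℝ) := (v i).comp ⟨fun b => b i, continuous_apply i⟩ with hvi
  set c := ∫ b, (sumCoord A v b - v i (b i)) ∂Q with hc
  set d : C(A i, ℝ) := gibbsPayoff μ ψ v i - v i with hd
  -- Conditionally on the action `x` of player `i`, the mean of `ψ - sumCoord v` is the expected
  -- payoff minus `v i x`, up to the constant `c`, which drops out of the covariance.
  have hcond : ∀ x, ∫ b, (ψ - sumCoord A v) (Function.update b i x) ∂Q = d x - c := by
    intro x
    have e1 : ∀ b, (ψ - sumCoord A v) (Function.update b i x)
        = ψ (Function.update b i x) - (v i x + (sumCoord A v b - v i (b i))) := fun b => by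
      rw [ContinuousMap.sub_apply, sumCoord_update]
    simp_rw [e1]
    have i1 : Integrable (fun b => ψ (Function.update b i x)) Q :=
      (ψ.comp ⟨fun b => Function.update b i x,
        Continuous.update continuous_id i continuous_const⟩).integrable Q
    have i2 : Integrable (fun b => sumCoord A v b - v i (b i)) Q := (sumCoord A v - vi).integrable Q
    have i3 : Integrable (fun b => v i x + (sumCoord A v b - v i (b i))) Q :=
      (integrable_const _).add i2
    rw [integral_sub i1 i3, integral_add (integrable_const _) i2, integral_const, hd, ContinuousMap.sub_apply, gibbsPayoff, integral_payoffAgainst_apply]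
    simp [hc]
    ring
  have e1 : ∫ b, h (b i) * (ψ b - sumCoord A v b) ∂Q
      = ∫ x, h x * (d x - c) ∂((μ i).tilted (v i)) := by
    have := integral_pi_eq_integral_update (ν := fun i => (μ i).tilted (v i)) i
      (hi * (ψ - sumCoord A v))
    rw [hpt] at this
    refine Eq.trans this (integral_congr_ae (ae_of_all _ fun x => ?_))
    simp only [ContinuousMap.mul_apply, hhi, ContinuousMap.comp_apply, ContinuousMap.coe_mk,
      Function.update_self]
    rw [integral_const_mul, hcond]
  have e2 : ∫ b, h (b i) ∂Q = ∫ x, h x ∂((μ i).tilted (v i)) := by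
    have := integral_pi_eq_integral_update (ν := fun i => (μ i).tilted (v i)) i hi
    rw [hpt] at this
    refine Eq.trans this (integral_congr_ae (ae_of_all _ fun x => ?_))
    simp [hhi]
  have e3 : ∫ b, (ψ b - sumCoord A v b) ∂Q = ∫ x, (d x - c) ∂((μ i).tilted (v i)) := by
    have := integral_pi_eq_integral_update (ν := fun i => (μ i).tilted (v i)) i (ψ - sumCoord A v)
    rw [hpt] at this
    exact Eq.trans this (integral_congr_ae (ae_of_all _ fun x => hcond x))
  have e4 : ∀ x, gibbsPayoff μ ψ v i x - v i x = d x := fun x => rfl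
  simp_rw [e4]
  rw [e1, e2, e3]
  simp_rw [mul_sub]
  rw [integral_sub (d.integrable _) (integrable_const _),
    integral_sub (f := fun x => h x * d x) ((h * d).integrable _) ((h.integrable _).mul_const c),
    integral_mul_const, integral_const]
  simp
  ring

/-- The free energy of the product of the Gibbs measures with log-densities `v`. -/
def productFreeEnergy (μ : ∀ i, Measure (A i)) [∀ i, IsFiniteMeasure (μ i)]
    (ψ : C(∀ i, A i, ℝ)) (v : ∀ i, C(A i, ℝ)) : ℝ :=
  freeEnergy (Measure.pi μ) ψ (sumCoord A v)

theorem contDiff_productFreeEnergy (ψ : C(∀ i, A i, ℝ)) :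
    ContDiff ℝ ω (productFreeEnergy μ ψ) :=
  (contDiff_freeEnergy ψ).comp (sumCoord A).contDiff

/-- The direction is a sum of functions of one coordinate and covariance is bilinear, so each player
contributes separately, through the player's own expected payoff. -/
theorem fderiv_productFreeEnergy (ψ : C(∀ i, A i, ℝ)) (v h : ∀ i, C(A i, ℝ)) :
    fderiv ℝ (productFreeEnergy μ ψ) v h = ∑ i,
      (∫ x, h i x * (gibbsPayoff μ ψ v i x - v i x) ∂((μ i).tilted (v i)) -
        (∫ x, h i x ∂((μ i).tilted (v i))) *
          ∫ x, (gibbsPayoff μ ψ v i x - v i x) ∂((μ i).tilted (v i))) := by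
  have hp' := isProbabilityMeasure_tilted_continuousMap (μ := Measure.pi μ) (sumCoord A v)
  have h1 : HasFDerivAt (productFreeEnergy μ ψ) _ v :=
    ((contDiff_freeEnergy (μ := Measure.pi μ) ψ).differentiable (by simp)
      (sumCoord A v)).hasFDerivAt.comp v (sumCoord A).hasFDerivAt
  rw [h1.fderiv, ContinuousLinearMap.comp_apply, fderiv_freeEnergy]
  have hi : ∀ i, Integrable (fun b : ∀ i, A i => h i (b i))
      ((Measure.pi μ).tilted (sumCoord A v)) := fun i =>
    ((h i).comp ⟨fun b : ∀ i, A i => b i, continuous_apply i⟩).integrable _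
  have hi' : ∀ i, Integrable (fun b : ∀ i, A i => h i (b i) * (ψ b - sumCoord A v b))
      ((Measure.pi μ).tilted (sumCoord A v)) := fun i =>
    ((h i).comp ⟨fun b : ∀ i, A i => b i, continuous_apply i⟩ * (ψ - sumCoord A v)).integrable _
  simp_rw [sumCoord_apply h, Finset.sum_mul]
  rw [integral_finsetSum _ fun i _ => hi i, integral_finsetSum _ fun i _ => hi' i,
    Finset.sum_mul, ← Finset.sum_sub_distrib]
  exact Finset.sum_congr rfl fun i _ => covariance_coordinate ψ v i (h i)

end Product

/-! ### Reduction of the critical value problem to finite dimension. -/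

section Reduction

open scoped ContDiff

/-- A continuous function on a compact space is uniformly close to a strongly measurable function
with values in a finite-dimensional subspace. -/
theorem Continuous.exists_finiteDimensional_approx {B Y : Type*} [TopologicalSpace B]
    [CompactSpace B] [SecondCountableTopology B] [MeasurableSpace B] [BorelSpace B]
    [NormedAddCommGroup Y] [NormedSpace ℝ Y] {F : B → Y} (hF : Continuous F) {ε : ℝ} (hε : 0 < ε) :
    ∃ (H : B → Y) (S : Submodule ℝ Y), StronglyMeasurable H ∧ FiniteDimensional ℝ S ∧
      (∀ b, H b ∈ S) ∧ ∀ b, ‖F b - H b‖ ≤ ε := by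
  rcases isEmpty_or_nonempty B with hB | hB
  · exact ⟨F, ⊥, StronglyMeasurable.of_discrete, inferInstance, fun b => hB.elim b,
      fun b => hB.elim b⟩
  borelize Y
  set e : ℕ → Y := fun n => F (TopologicalSpace.denseSeq B n) with he
  obtain ⟨t, ht⟩ := isCompact_univ.elim_finite_subcover (fun n => {b | dist (F b) (e n) < ε})
    (fun n => isOpen_lt (hF.dist continuous_const) continuous_const) (fun b _ => by
      have h1 : IsOpen {b' | dist (F b) (F b') < ε} :=
        isOpen_lt (continuous_const.dist hF) continuous_const
      obtain ⟨_, h2, n, rfl⟩ := (TopologicalSpace.denseRange_denseSeq B).inter_open_nonempty _ h1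
        ⟨b, by simpa using hε⟩
      exact mem_iUnion.2 ⟨n, h2⟩)
  -- The nearest-point map to a finite `ε`-net of the compact image is a measurable choice with
  -- finitely many values.
  set P := SimpleFunc.nearestPt e (t.sup id) with hP
  refine ⟨fun b => P (F b), Submodule.span ℝ (P.range : Set Y),
    P.stronglyMeasurable.comp_measurable hF.measurable,
    FiniteDimensional.span_of_finite ℝ (Finset.finite_toSet _),
    fun b => Submodule.subset_span (by simp), fun b => ?_⟩
  obtain ⟨n, hn, hb⟩ := mem_iUnion₂.1 (ht (mem_univ b))
  have h1 := SimpleFunc.edist_nearestPt_le e (F b) (k := n) (N := t.sup id)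
    (Finset.le_sup (f := id) hn)
  rw [← dist_eq_norm, dist_comm]
  rw [edist_dist, edist_dist, ENNReal.ofReal_le_ofReal_iff dist_nonneg] at h1
  refine h1.trans ?_
  rw [dist_comm]
  exact le_of_lt hb

variable {ι : Type} [Fintype ι] [DecidableEq ι] {A : ι → Type} [∀ i, TopologicalSpace (A i)]
  [∀ i, CompactSpace (A i)] [∀ i, SecondCountableTopology (A i)] [∀ i, MeasurableSpace (A i)]
  [∀ i, BorelSpace (A i)] {μ : ∀ i, Measure (A i)} [∀ i, IsFiniteMeasure (μ i)]
  [∀ i, NeZero (μ i)]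

/-- The families of log-densities of equilibria, not necessarily normalized. -/
def equilibriumLogDensities (μ : ∀ i, Measure (A i)) (ψ : C(∀ i, A i, ℝ)) :
    Set (∀ i, C(A i, ℝ)) :=
  {v | ∃ c : ι → ℝ, ∀ i, v i = gibbsPayoff μ ψ v i + ContinuousMap.const _ (c i)}

/-- At an equilibrium the payoff and the log-density differ by a constant, and covariances with
constants vanish. -/
theorem fderiv_productFreeEnergy_eq_zero {ψ : C(∀ i, A i, ℝ)} {v : ∀ i, C(A i, ℝ)}
    (hv : v ∈ equilibriumLogDensities μ ψ) : fderiv ℝ (productFreeEnergy μ ψ) v = 0 := by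
  obtain ⟨c, hc⟩ := hv
  ext1 h
  rw [fderiv_productFreeEnergy, zero_apply]
  refine Finset.sum_eq_zero fun i _ => ?_
  have := isProbabilityMeasure_tilted_continuousMap (μ := μ i) (v i)
  have h1 : ∀ x, gibbsPayoff μ ψ v i x - v i x = -c i := by
    intro x
    have := congrArg (fun f : C(A i, ℝ) => f x) (hc i)
    simp only [ContinuousMap.add_apply, ContinuousMap.const_apply] at this
    linarith
  simp_rw [h1]
  rw [integral_mul_const, integral_const]
  simp

theorem norm_integral_tilted_le {B Y : Type*} [TopologicalSpace B] [CompactSpace B]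
    [MeasurableSpace B] [BorelSpace B] [NormedAddCommGroup Y] [NormedSpace ℝ Y] {μ : Measure B}
    [IsFiniteMeasure μ] [NeZero μ] {H : B → Y} {ε : ℝ} (hε : ∀ b, ‖H b‖ ≤ ε) (y : C(B, ℝ)) :
    ‖∫ b, H b ∂(μ.tilted y)‖ ≤ ε := by
  have := isProbabilityMeasure_tilted_continuousMap (μ := μ) y
  simpa using norm_integral_le_of_norm_le_const (μ := μ.tilted y) (ae_of_all _ hε)

/-- Each of the two terms of the covariance is at most `ε * ‖k‖`. A uniformly small integrand thus
gives a map of `y` with uniformly small derivative. -/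
theorem norm_fderiv_integral_tilted_le {B Y : Type*} [TopologicalSpace B] [CompactSpace B]
    [MeasurableSpace B] [BorelSpace B] [NormedAddCommGroup Y] [NormedSpace ℝ Y] {μ : Measure B}
    [IsFiniteMeasure μ] [NeZero μ] {H : B → Y} (hH : Integrable H μ) {ε : ℝ}
    (hε : ∀ b, ‖H b‖ ≤ ε) (y k : C(B, ℝ)) :
    ‖fderiv ℝ (fun y : C(B, ℝ) => ∫ b, H b ∂(μ.tilted y)) y k‖ ≤ 2 * ε * ‖k‖ := by
  rw [(hasFDerivAt_integral_tilted hH y).fderiv]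
  simp only [sub_apply, ContinuousLinearMap.smulRight_apply, weightedIntegral_apply, smul_eq_mul,
    mul_one]
  refine (norm_sub_le _ _).trans ?_
  rw [norm_smul]
  have h1 : ‖∫ b, k b • H b ∂(μ.tilted y)‖ ≤ ‖k‖ * ε :=
    norm_integral_tilted_le (fun b => by
      rw [norm_smul]
      exact mul_le_mul (k.norm_coe_le_norm b) (hε b) (norm_nonneg _) (norm_nonneg _)) y
  have h2 : ‖∫ b, k b ∂(μ.tilted y)‖ ≤ ‖k‖ :=
    norm_integral_tilted_le (fun b => k.norm_coe_le_norm b) y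
  have h3 := norm_integral_tilted_le hε y (μ := μ)
  have h4 := mul_le_mul h2 h3 (norm_nonneg _) (norm_nonneg _)
  linarith

/-- The map `v ↦ v - R v` is an analytic diffeomorphism if `R` is analytic with derivative of norm
at most `1/2`. -/
theorem exists_homeomorph_sub {X : Type*} [NormedAddCommGroup X] [NormedSpace ℝ X]
    [CompleteSpace X] {R : X → X} (hR : ContDiff ℝ ω R) (hR' : ∀ v, ‖fderiv ℝ R v‖ ≤ 1 / 2) :
    ∃ g : X ≃ₜ X, (∀ v, g v = v - R v) ∧ ContDiff ℝ ω g.symm := by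
  have hd : Differentiable ℝ R := hR.differentiable (by simp)
  have hlip : LipschitzWith (1 / 2) R := lipschitzWith_of_nnnorm_fderiv_le hd fun v => hR' v
  have happ : ApproximatesLinearOn (fun v => v - R v)
      ((ContinuousLinearEquiv.refl ℝ X : X ≃L[ℝ] X) : X →L[ℝ] X) univ (1 / 2) := by
    intro x _ y _
    have h1 := hlip.dist_le_mul y x
    rw [dist_eq_norm, dist_eq_norm, norm_sub_rev y x] at h1
    have h2 : x - R x - (y - R y) - (x - y) = R y - R x := by abel
    simp only [ContinuousLinearEquiv.coe_coe, ContinuousLinearEquiv.refl_apply]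
    rw [h2]
    exact h1
  have hc : Subsingleton X ∨
      (1 / 2 : ℝ≥0) < ‖((ContinuousLinearEquiv.refl ℝ X).symm : X →L[ℝ] X)‖₊⁻¹ := by
    rcases subsingleton_or_nontrivial X with h | h
    · exact Or.inl h
    · right
      have h1 : ‖((ContinuousLinearEquiv.refl ℝ X).symm : X →L[ℝ] X)‖₊ = 1 := by
        ext
        exact ContinuousLinearMap.norm_id
      rw [h1, inv_one]
      exact NNReal.half_lt_self one_ne_zero
  set g := happ.toHomeomorph _ hc with hg
  have hgv : ∀ v, g v = v - R v := fun v => rfl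
  refine ⟨g, hgv, ?_⟩
  have hlt : ∀ v, ‖fderiv ℝ R v‖ < 1 := fun v => (hR' v).trans_lt (by norm_num)
  -- The derivative `id - DR` is invertible by the Neumann series, so the inverse homeomorphism is
  -- analytic.
  refine g.contDiff_symm
    (f₀' := fun v => ContinuousLinearEquiv.ofUnit (Units.oneSub (fderiv ℝ R v) (hlt v)))
    (fun v => ?_) ?_
  · have h1 := (hasFDerivAt_id (𝕜 := ℝ) v).sub (hd v).hasFDerivAt
    exact h1
  · exact contDiff_id.sub hR

/-- Critical values of an analytic function are negligible if, in an analytic chart, the critical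
points lie in a finite-dimensional subspace. -/
theorem volume_image_eq_zero_of_finiteDimensional {X : Type} [NormedAddCommGroup X]
    [NormedSpace ℝ X] {W : X → ℝ} (hW : ContDiff ℝ ω W) {g : X ≃ₜ X} (hg : ContDiff ℝ ω g.symm)
    {T : Submodule ℝ X} [FiniteDimensional ℝ T] {C : Set X}
    (hC : ∀ v ∈ C, g v ∈ T ∧ fderiv ℝ W v = 0) : volume (W '' C) = 0 := by
  set f : T → ℝ := fun w => W (g.symm w) with hf
  have hfc : ContDiff ℝ ω f := hW.comp (hg.comp T.subtypeL.contDiff)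
  have hsub : W '' C ⊆ f '' {w | fderiv ℝ f w = 0} := by
    rintro _ ⟨v, hv, rfl⟩
    refine ⟨⟨g v, (hC v hv).1⟩, ?_, by simp [hf]⟩
    have h1 : HasFDerivAt f _ (⟨g v, (hC v hv).1⟩ : T) :=
      (hW.differentiable (by simp) _).hasFDerivAt.comp _
        ((hg.differentiable (by simp) _).hasFDerivAt.comp (⟨g v, (hC v hv).1⟩ : T)
          T.subtypeL.hasFDerivAt)
    rw [mem_ofPred_eq, h1.fderiv]
    simp only [Homeomorph.symm_apply_apply]
    rw [(hC v hv).2, ContinuousLinearMap.zero_comp]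
  refine measure_mono_null hsub ?_
  exact volume_image_eq_zero_of_fderiv_eq_zero _ T rfl f _
    (fun w _ => hfc.contDiffAt.analyticAt) fun w hw => hw

/-- The free energy takes a negligible set of values at equilibria. -/
theorem volume_image_equilibriumLogDensities (ψ : C(∀ i, A i, ℝ)) :
    volume (productFreeEnergy μ ψ '' equilibriumLogDensities μ ψ) = 0 := by
  set n := Fintype.card ι with hn
  -- The covariance bound costs a factor `2` and `sumCoord` a factor `n`; this choice gives `2 * ε *
  -- n ≤ 1 / 2`.
  set ε : ℝ := 1 / (4 * (n + 1)) with hε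
  have hε0 : 0 < ε := by positivity
  choose H S hHm hSf hHS hFH using fun i =>
    (payoffAgainst ψ i).continuous.exists_finiteDimensional_approx hε0
  have hFi : ∀ i, Integrable (payoffAgainst ψ i) (Measure.pi μ) := fun i =>
    integrable_payoffAgainst ψ i _
  have hDi : ∀ i, Integrable (fun b => payoffAgainst ψ i b - H i b) (Measure.pi μ) := fun i =>
    Integrable.of_bound ((hFi i).1.sub (hHm i).aestronglyMeasurable) ε (ae_of_all _ (hFH i))
  have hHi : ∀ i, Integrable (H i) (Measure.pi μ) := fun i => by
    refine ((hFi i).sub (hDi i)).congr (ae_of_all _ fun b => ?_)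
    simp
  set R : (∀ i, C(A i, ℝ)) → ∀ i, C(A i, ℝ) := fun v i =>
    ∫ b, (payoffAgainst ψ i b - H i b) ∂((Measure.pi μ).tilted (sumCoord A v)) with hR
  have hRi : ∀ i, ContDiff ℝ ω fun v => R v i := fun i =>
    (contDiff_integral_tilted (hDi i)).comp (sumCoord A).contDiff
  have hRc : ContDiff ℝ ω R := contDiff_pi.2 hRi
  have hR' : ∀ v, ‖fderiv ℝ R v‖ ≤ 1 / 2 := by
    intro v
    refine ContinuousLinearMap.opNorm_le_bound _ (by norm_num) fun h => ?_
    rw [pi_norm_le_iff_of_nonneg (by positivity)]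
    intro i
    have e1 : fderiv ℝ R v h i = fderiv ℝ (fun y : C(∀ i, A i, ℝ) =>
        ∫ b, (payoffAgainst ψ i b - H i b) ∂((Measure.pi μ).tilted y)) (sumCoord A v)
          (sumCoord A h) := by
      have h1 : HasFDerivAt (fun v => R v i) _ v :=
        ((contDiff_integral_tilted (hDi i)).differentiable (by simp)
          (sumCoord A v)).hasFDerivAt.comp v (sumCoord A).hasFDerivAt
      have h2 := hasFDerivAt_pi'.1 (hRc.differentiable (by simp) v).hasFDerivAt i
      have h3 := congrArg (fun B => B h) (h2.unique h1)
      exact h3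
    rw [e1]
    refine (norm_fderiv_integral_tilted_le (hDi i) (hFH i) _ _).trans ?_
    calc 2 * ε * ‖sumCoord A h‖ ≤ 2 * ε * (n * ‖h‖) := by
          gcongr
          exact norm_sumCoord_apply_le h
      _ = (2 * ε * n) * ‖h‖ := by ring
      _ ≤ 1 / 2 * ‖h‖ := by
          gcongr
          rw [hε, mul_one_div, div_mul_eq_mul_div, div_le_div_iff₀ (by positivity) two_pos]
          linarith
  obtain ⟨g, hg, hgs⟩ := exists_homeomorph_sub hRc hR'
  -- At an equilibrium, `v - R v` is an average of the `S i`-valued `H i` plus a constant, so the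
  -- constants are adjoined to `S i`.
  set S' : ∀ i, Submodule ℝ C(A i, ℝ) := fun i =>
    S i ⊔ Submodule.span ℝ {ContinuousMap.const _ 1} with hS'
  set T : Submodule ℝ (∀ i, C(A i, ℝ)) := LinearMap.range
    (LinearMap.pi fun i => (S' i).subtype.comp (LinearMap.proj i) : (∀ i, S' i) →ₗ[ℝ] _) with hT
  refine volume_image_eq_zero_of_finiteDimensional (contDiff_productFreeEnergy ψ) hgs (T := T)
    fun v hv => ⟨?_, fderiv_productFreeEnergy_eq_zero hv⟩
  obtain ⟨c, hc⟩ := hv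
  have h1 : ∀ i, g v i ∈ S' i := by
    intro i
    have := isProbabilityMeasure_tilted_continuousMap (μ := Measure.pi μ) (sumCoord A v)
    have h2 : g v i = ∫ b, H i b ∂((Measure.pi μ).tilted (sumCoord A v))
        + c i • ContinuousMap.const _ 1 := by
      rw [hg, Pi.sub_apply]
      simp only [hR]
      rw [integral_sub (integrable_payoffAgainst ψ i _)
        (integrable_tilted_continuousMap (hHi i) _)]
      conv_lhs => rw [hc i]
      rw [gibbsPayoff]
      ext x
      simp
      ring
    rw [h2]
    refine add_mem (Submodule.mem_sup_left ?_) (Submodule.mem_sup_right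
      (Submodule.smul_mem _ _ (Submodule.mem_span_singleton_self _)))
    exact (S i).convex.integral_mem (Submodule.closed_of_finiteDimensional _)
      (ae_of_all _ (hHS i)) (integrable_tilted_continuousMap (hHi i) _)
  exact ⟨fun i => ⟨g v i, h1 i⟩, rfl⟩

end Reduction

/-! ### Signed measures with continuous densities, and normalized exponentials. -/

section Densities

variable {X : Type*} [MetricSpace X] [CompactSpace X] [MeasurableSpace X] [BorelSpace X]

/-- The signed measure with a given continuous density. -/
def densityBL (μ : Measure X) [IsFiniteMeasure μ] : C(X, ℝ) →L[ℝ] BLMeasure X :=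
  LinearMap.mkContinuous
    { toFun := fun f => (μ.withDensityᵥ f : SignedMeasure X)
      map_add' := fun f g => withDensityᵥ_add (f.integrable μ) (g.integrable μ)
      map_smul' := fun c f => withDensityᵥ_smul (μ := μ) (f : X → ℝ) c }
    (‖(ContinuousLinearMap.lsmul ℝ ℝ (E := ℝ)).flip‖ * μ.real univ) fun f => by
      refine ciSup_le fun g => ?_
      have hv : (μ.withDensityᵥ f).variation = μ.withDensity fun x => ‖f x‖ₑ :=
        Measure.variation_withDensityᵥ (f.integrable μ)
      have hfin := BLMeasure.isFiniteMeasure_variation (μ.withDensityᵥ f)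
      refine (VectorMeasure.norm_integral_le_integral_norm (μ := μ.withDensityᵥ f)
        (B := (ContinuousLinearMap.lsmul ℝ ℝ (E := ℝ)).flip)).trans ?_
      rw [mul_assoc]
      refine mul_le_mul_of_nonneg_left ?_
        (norm_nonneg ((ContinuousLinearMap.lsmul ℝ ℝ).flip : ℝ →L[ℝ] ℝ →L[ℝ] ℝ))
      refine (integral_mono (BLMeasure.integrable_of_mem (X := X) _ g.2).norm (integrable_const _)
        fun a => abs_le_one_of_mem_blTestFunctions g.2 a).trans ?_
      rw [integral_const, smul_eq_mul, mul_one, measureReal_def, hv,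
        withDensity_apply _ MeasurableSet.univ, Measure.restrict_univ, measureReal_def]
      refine (ENNReal.toReal_mono (ENNReal.mul_ne_top (by simp) (measure_ne_top μ univ)) ?_).trans
        (ENNReal.toReal_mul (a := ‖f‖ₑ) (b := μ univ)).le |>.trans ?_
      · rw [← setLIntegral_univ, ← setLIntegral_const]
        refine lintegral_mono fun x => ?_
        rw [enorm_le_iff_norm_le]
        exact f.norm_coe_le_norm x
      · rw [toReal_enorm, mul_comm]

theorem densityBL_apply (μ : Measure X) [IsFiniteMeasure μ] (f : C(X, ℝ)) :
    densityBL μ f = (μ.withDensityᵥ f : SignedMeasure X) := rfl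

theorem densityBL_injective (μ : Measure X) [IsFiniteMeasure μ] [μ.IsOpenPosMeasure] :
    Function.Injective (densityBL μ) := by
  intro f g h
  have h1 := (f.integrable μ).ae_eq_of_withDensityᵥ_eq (g.integrable μ) h
  exact ContinuousMap.ext fun x => congrFun ((f.continuous.ae_eq_iff_eq μ g.continuous).1 h1) x

/-- The normalized exponential of a continuous function. -/
def softmax (μ : Measure X) [IsFiniteMeasure μ] (f : C(X, ℝ)) : C(X, ℝ) :=
  (partitionFunction μ f)⁻¹ • f.pexp

theorem softmax_apply (μ : Measure X) [IsFiniteMeasure μ] (f : C(X, ℝ)) (x : X) :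
    softmax μ f x = (partitionFunction μ f)⁻¹ * Real.exp (f x) := rfl

variable {μ : Measure X} [IsFiniteMeasure μ] [NeZero μ]

theorem continuous_softmax : Continuous (softmax μ) :=
  ((contDiff_partitionFunction (μ := μ)).continuous.inv₀
    fun f => (partitionFunction_pos f).ne').smul ContinuousMap.contDiff_pexp.continuous

theorem softmax_pos (f : C(X, ℝ)) (x : X) : 0 < softmax μ f x :=
  mul_pos (inv_pos.2 (partitionFunction_pos f)) (Real.exp_pos _)

theorem log_softmax (f : C(X, ℝ)) (x : X) :
    Real.log (softmax μ f x) = f x - Real.log (partitionFunction μ f) := by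
  rw [softmax_apply, Real.log_mul (inv_ne_zero (partitionFunction_pos f).ne') (Real.exp_ne_zero _),
    Real.log_inv, Real.log_exp]
  ring

theorem integral_softmax (f : C(X, ℝ)) : ∫ x, softmax μ f x ∂μ = 1 := by
  simp_rw [softmax_apply]
  rw [integral_const_mul, ← partitionFunction_eq, inv_mul_cancel₀ (partitionFunction_pos f).ne']

theorem toBL_tilted (f : C(X, ℝ)) (h : IsProbabilityMeasure (μ.tilted f)) :
    MixedStrategy.toBL ⟨μ.tilted f, h⟩ = densityBL μ (softmax μ f) := by
  have h1 : ∀ x, softmax μ f x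
      = (ENNReal.ofReal (Real.exp (f x) / ∫ x, Real.exp (f x) ∂μ)).toReal := by
    intro x
    rw [ENNReal.toReal_ofReal (div_nonneg (Real.exp_pos _).le
      (integral_nonneg fun _ => (Real.exp_pos _).le)), softmax_apply, partitionFunction_eq,
      div_eq_inv_mul]
  have hm : AEMeasurable (fun x => ENNReal.ofReal (Real.exp (f x) / ∫ x, Real.exp (f x) ∂μ)) μ :=
    ((f.pexp.continuous.measurable.div_const _).ennreal_ofReal).aemeasurable
  have hfin : ∫⁻ x, ENNReal.ofReal (Real.exp (f x) / ∫ x, Real.exp (f x) ∂μ) ∂μ ≠ ∞ := by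
    have h2 := h.measure_univ
    rw [Measure.tilted, withDensity_apply _ MeasurableSet.univ, Measure.restrict_univ] at h2
    rw [h2]
    exact ENNReal.one_ne_top
  have h3 := withDensityᵥ_toReal hm hfin
  rw [densityBL_apply]
  have h4 : (⇑(softmax μ f) : X → ℝ)
      = fun x => (ENNReal.ofReal (Real.exp (f x) / ∫ x, Real.exp (f x) ∂μ)).toReal := funext h1
  rw [h4]
  exact h3.symm

/-- Normalization cancels the factor `exp c`. Hence payoffs matter only up to constants, and
utilities may be replaced by the potential. -/
theorem tilted_eq_of_sub_const {f g : X → ℝ} (c : ℝ) (h : ∀ x, f x = g x + c) :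
    μ.tilted f = μ.tilted g := by
  unfold Measure.tilted
  congr 1
  ext x
  simp_rw [h, Real.exp_add, integral_mul_const]
  rw [mul_div_mul_right _ _ (Real.exp_ne_zero c)]

end Densities

/-- Mazur's theorem: the convex hull of a totally bounded set is totally bounded, and its closure is
complete. -/
theorem isCompact_closedConvexHull {E : Type*} [NormedAddCommGroup E] [NormedSpace ℝ E]
    [CompleteSpace E] {s : Set E} (hs : IsCompact s) : IsCompact (closedConvexHull ℝ s) := by
  rw [closedConvexHull_eq_closure_convexHull]
  exact isCompact_iff_totallyBounded_isComplete.2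
    ⟨hs.totallyBounded.convexHull.closure, isClosed_closure.isComplete⟩

/-! ### Continuous potentials and the logit response as a Gibbs measure. -/

namespace ContinuousActionGame

variable {N : ℕ} {G : ContinuousActionGame N}

instance isOpenPosMeasure_lebesgue (i : Fin N) : (G.lebesgue i).IsOpenPosMeasure := by
  refine ⟨fun U hU ⟨x, hx⟩ => ?_⟩
  obtain ⟨V, hV, rfl⟩ := isOpen_induced_iff.1 hU
  rw [lebesgue, comap_subtype_coe_apply measurableSet_Icc, Subtype.image_preimage_coe]
  have h1 : ((x : ℝ)) ∈ closure (Ioo (G.lo i) (G.hi i)) := by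
    rw [closure_Ioo (G.lo_lt_hi i).ne]
    exact x.2
  have h2 := mem_closure_iff.1 h1 V hV hx
  have h3 := (hV.inter isOpen_Ioo).measure_pos volume h2
  refine (h3.trans_le (measure_mono ?_)).ne'
  rintro y ⟨hy1, hy2⟩
  exact ⟨Ioo_subset_Icc_self hy2, hy1⟩

variable (G) in
/-- The continuous function `φ` is a potential of the game. -/
def IsContinuousPotential (φ : C((i : Fin N) → G.Action i, ℝ)) : Prop :=
  ∀ (i : Fin N) (a : (i : Fin N) → G.Action i) (b b' : G.Action i),
    G.utility i (Function.update a i b) - G.utility i (Function.update a i b')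
      = φ (Function.update a i b) - φ (Function.update a i b')

/-- A potential game has a continuous potential. -/
theorem IsPotentialGame.exists_continuous (hG : G.IsPotentialGame) :
    ∃ φ, G.IsContinuousPotential φ := by
  obtain ⟨φ, hφ⟩ := hG
  set a₀ : (i : Fin N) → G.Action i := fun i => ⟨G.lo i, left_mem_Icc.2 (G.lo_lt_hi i).le⟩
  -- Switch coordinates from `a₀` to `a` one at a time: each switch changes `φ` by a difference of
  -- utilities, which is continuous.
  have hc : ∀ s : Finset (Fin N), Continuous fun a => φ (s.piecewise a a₀) := by
    intro s
    induction s using Finset.induction_on with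
    | empty => simpa using continuous_const
    | insert i s hi ih =>
      have hpc : Continuous fun a : (i : Fin N) → G.Action i => s.piecewise a a₀ := by
        refine continuous_pi fun j => ?_
        by_cases hj : j ∈ s
        · simpa [hj] using continuous_apply j
        · simpa [hj] using continuous_const
      have h1 : ∀ a : (i : Fin N) → G.Action i, φ ((insert i s).piecewise a a₀)
          = φ (s.piecewise a a₀) + (G.utility i (Function.update (s.piecewise a a₀) i (a i))
            - G.utility i (Function.update (s.piecewise a a₀) i (a₀ i))) := by
        intro a
        have h2 : Function.update (s.piecewise a a₀) i (a₀ i) = s.piecewise a a₀ := by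
          rw [Function.update_eq_self_iff]
          simp [hi]
        rw [hφ i, h2, Finset.piecewise_insert]
        ring
      simp_rw [h1]
      exact ih.add (((G.continuous_utility i).comp (hpc.update i (continuous_apply i))).sub
        ((G.continuous_utility i).comp (hpc.update i continuous_const)))
  exact ⟨⟨φ, by simpa using hc Finset.univ⟩, hφ⟩

/-- In a potential game the logit response is the Gibbs measure of the expected potential. -/
theorem logitResponse_toMeasure {φ : C((i : Fin N) → G.Action i, ℝ)}
    (hφ : G.IsContinuousPotential φ) (η : ℝ) (π : G.Profile) (i : Fin N) : (G.logitResponse η π i).toMeasure = (G.lebesgue i).tilted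
      (∫ b, payoffAgainst (η⁻¹ • φ) i b ∂(Measure.pi fun j => (π j).toMeasure) : C(G.Action i, ℝ)) := by
  set Q := Measure.pi fun j => (π j).toMeasure with hQ
  set x₀ : G.Action i := ⟨G.lo i, left_mem_Icc.2 (G.lo_lt_hi i).le⟩
  have hu : ∀ x : G.Action i, Integrable (fun b => G.utility i (Function.update b i x)) Q :=
    fun x => ContinuousMap.integrable Q ⟨fun b => G.utility i (Function.update b i x),
      (G.continuous_utility i).comp (continuous_id.update i continuous_const)⟩
  have hp : ∀ x : G.Action i, Integrable (fun b => φ (Function.update b i x)) Q :=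
    fun x => ContinuousMap.integrable Q ⟨fun b => φ (Function.update b i x),
      φ.continuous.comp (continuous_id.update i continuous_const)⟩
  -- Utility minus potential does not depend on the player's own action, so its mean can be read off
  -- at the reference action `x₀`.
  refine tilted_eq_of_sub_const (η⁻¹ * (∫ b, G.utility i (Function.update b i x₀) ∂Q
    - ∫ b, φ (Function.update b i x₀) ∂Q)) fun x => ?_
  rw [integral_payoffAgainst_apply, expectedUtility]
  simp only [ContinuousMap.smul_apply, smul_eq_mul]
  rw [integral_const_mul, ← mul_add]
  have h1 : ∫ b, (G.utility i (Function.update b i x) - G.utility i (Function.update b i x₀)) ∂Q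
      = ∫ b, (φ (Function.update b i x) - φ (Function.update b i x₀)) ∂Q :=
    integral_congr_ae (ae_of_all _ fun b => hφ i b x x₀)
  rw [integral_sub (hu x) (hu x₀), integral_sub (hp x) (hp x₀)] at h1
  congr 1
  linarith

end ContinuousActionGame

/-! ### Relaxation, lifting and differentiation of trajectories. -/

section Trajectories

/-- If a flow relaxes towards points of a closed convex set, then every compact invariant set is
contained in it. -/
theorem mem_of_relaxation {M E : Type*} [TopologicalSpace M] [NormedAddCommGroup E]
    [NormedSpace ℝ E] {Φ : Flow ℝ≥0 M} {τ L : M → E} {K : Set E} {Λ : Set M} (hτ : Continuous τ)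
    (hK : Convex ℝ K) (hKc : IsClosed K) (hL : ∀ π, L π ∈ K)
    (hΦ : ∀ (π : M) (t : ℝ≥0), HasDerivWithinAt (fun s : ℝ => τ (Φ s.toNNReal π))
      (L (Φ t π) - τ (Φ t π)) (Ici 0) (t : ℝ))
    (hΛ : IsCompact Λ) (hinv : ∀ t, Φ t '' Λ = Λ) {π : M} (hπ : π ∈ Λ) : τ π ∈ K := by
  by_contra hπK
  obtain ⟨f, u, hfK, hfu⟩ := geometric_hahn_banach_closed_point hK hKc hπK
  obtain ⟨C, hC⟩ := hΛ.exists_bound_of_continuousOn (f.continuous.comp hτ).continuousOn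
  -- Invariance gives a `ρ ∈ Λ` that reaches `π` at time `t`. Along its trajectory `exp s * (f - u)`
  -- decreases because `f ≤ u` on responses, and it starts below `C - u`. Large `t` then contradicts
  -- `f (τ π) > u`.
  have key : ∀ t : ℝ≥0, Real.exp t * (f (τ π) - u) ≤ C - u := by
    intro t
    obtain ⟨ρ, hρ, hρπ⟩ := (hinv t).symm.subset hπ
    have hd : ∀ s : ℝ, 0 ≤ s → HasDerivWithinAt
        (fun s : ℝ => Real.exp s * (f (τ (Φ s.toNNReal ρ)) - u))
        (Real.exp s * (f (L (Φ s.toNNReal ρ)) - u)) (Ici 0) s := by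
      intro s hs
      have h1 := hΦ ρ s.toNNReal
      rw [Real.coe_toNNReal s hs] at h1
      have h2 := (Real.hasDerivAt_exp s).hasDerivWithinAt.mul
        ((f.hasFDerivAt.comp_hasDerivWithinAt s h1).sub_const u) (s := Ici 0)
      refine h2.congr_deriv ?_
      simp only [map_sub, Function.comp_apply]
      ring
    have hanti : AntitoneOn (fun s : ℝ => Real.exp s * (f (τ (Φ s.toNNReal ρ)) - u)) (Ici 0) := by
      refine antitoneOn_of_hasDerivWithinAt_nonpos (convex_Ici 0)
        (fun s hs => (hd s hs).continuousWithinAt)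
        (fun s hs => (hd s (interior_subset hs)).mono interior_subset) fun s hs => ?_
      have := hfK _ (hL (Φ s.toNNReal ρ))
      exact mul_nonpos_of_nonneg_of_nonpos (Real.exp_pos s).le (by linarith)
    have h3 := hanti (mem_Ici.2 le_rfl) (mem_Ici.2 t.2) t.2
    have h4 := (abs_le.1 (hC ρ hρ)).2
    simp only [NNReal.val_eq_coe, Real.toNNReal_coe, hρπ, Real.exp_zero, one_mul,
      Real.toNNReal_zero, Φ.map_zero_apply, Function.comp_apply] at h3 h4
    linarith
  have hpos : 0 < f (τ π) - u := sub_pos.2 hfu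
  have h1 := tendsto_atTop.1 (Real.tendsto_exp_atTop.atTop_mul_const hpos) (C - u + 1)
  obtain ⟨t, ht, ht0⟩ := (h1.and (eventually_ge_atTop 0)).exists
  have h2 : Real.exp t * (f (τ π) - u) ≤ C - u := key ⟨t, ht0⟩
  linarith

/-- A lift along a continuous injection is continuous if it takes values in a compact set. -/
theorem continuousOn_lift {M E Y : Type*} [TopologicalSpace M] [TopologicalSpace E]
    [TopologicalSpace Y] [T2Space Y] {D : Set E} (hD : IsCompact D) {e : E → Y}
    (he : Continuous e) (hinj : Function.Injective e) {τ : M → Y} {Λ : Set M}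
    (hτ : ContinuousOn τ Λ) {l : M → E} (hlD : ∀ π ∈ Λ, l π ∈ D)
    (hl : ∀ π ∈ Λ, e (l π) = τ π) : ContinuousOn l Λ := by
  have := isCompact_iff_compactSpace.1 hD
  have hemb : IsClosedEmbedding fun d : D => e d :=
    (he.comp continuous_subtype_val).isClosedEmbedding (hinj.comp Subtype.val_injective)
  rw [continuousOn_iff_continuous_domRestrict]
  have h1 : Continuous fun π : Λ => (⟨l π, hlD π π.2⟩ : D) := by
    rw [hemb.isInducing.continuous_iff]
    have h2 : ((fun d : D => e d) ∘ fun π : Λ => (⟨l π, hlD π π.2⟩ : D)) = Λ.domRestrict τ := by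
      ext π
      exact hl π π.2
    rw [h2]
    exact continuousOn_iff_continuous_domRestrict.1 hτ
  exact continuous_subtype_val.comp h1

/-- A derivative may be computed after applying a separating family of continuous linear maps,
provided that it is continuous. -/
theorem hasDerivWithinAt_of_separating {E J : Type*} [NormedAddCommGroup E] [NormedSpace ℝ E]
    [CompleteSpace E] {Y : J → Type*} [∀ j, NormedAddCommGroup (Y j)] [∀ j, NormedSpace ℝ (Y j)]
    (e : ∀ j, E →L[ℝ] Y j) (he : ∀ x, (∀ j, e j x = 0) → x = 0) {p r : ℝ → E} (hr : Continuous r)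
    (hd : ∀ j t, 0 ≤ t → HasDerivWithinAt (fun s => e j (p s)) (e j (r t)) (Ici 0) t)
    {t : ℝ} (ht : 0 ≤ t) : HasDerivWithinAt p (r t) (Ici 0) t := by
  -- Every `e j` sees `p - q` as constant, so `p = p 0 + q` by separation, and the primitive `q` of
  -- a continuous function is differentiable in norm.
  set q : ℝ → E := fun t => ∫ s in (0 : ℝ)..t, r s with hq
  have hqd : ∀ t, HasDerivAt q (r t) t := fun t =>
    intervalIntegral.integral_hasDerivAt_right (hr.intervalIntegrable _ _)
      (hr.stronglyMeasurableAtFilter _ _) hr.continuousAt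
  have hpq : ∀ s ∈ Ici (0 : ℝ), p s = p 0 + q s := by
    intro s hs
    have h1 : ∀ j, e j (p s - q s) = e j (p 0 - q 0) := by
      intro j
      have h2 : ∀ t ∈ Ici (0 : ℝ),
          HasDerivWithinAt (fun s => e j (p s - q s)) 0 (Ici 0) t := by
        intro t ht
        have h3 := (hd j t ht).sub ((e j).hasFDerivAt.comp_hasDerivWithinAt t
          (hqd t).hasDerivWithinAt)
        rw [sub_self] at h3
        refine h3.congr_of_eventuallyEq (Eventually.of_forall fun x => ?_) ?_ <;> simp
      refine (convex_Ici (0 : ℝ)).is_const_of_fderivWithin_eq_zero (𝕜 := ℝ)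
        (fun t ht => (h2 t ht).differentiableWithinAt) (fun t ht => ?_) hs (mem_Ici.2 le_rfl)
      have h4 := (h2 t ht).hasFDerivWithinAt.fderivWithin (uniqueDiffOn_Ici 0 t ht)
      rw [h4]
      ext
      simp
    have h5 := he (p s - q s - (p 0 - q 0)) fun j => by rw [map_sub, h1 j, sub_self]
    have h6 : q 0 = 0 := by simp [hq]
    rw [h6, sub_zero, sub_eq_zero, sub_eq_iff_eq_add] at h5
    exact h5
  exact ((hqd t).hasDerivWithinAt.const_add (p 0)).congr hpq (hpq t ht)

end Trajectories

/-! ### Increase of the free energy along the logit dynamics. -/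

section Dissipation

variable {ι : Type} [Fintype ι] [DecidableEq ι] {A : ι → Type} [∀ i, MetricSpace (A i)]
  [∀ i, CompactSpace (A i)] [∀ i, MeasurableSpace (A i)]
  [∀ i, BorelSpace (A i)] {μ : ∀ i, Measure (A i)} [∀ i, IsFiniteMeasure (μ i)]
  [∀ i, NeZero (μ i)]

/-- The logit response dynamics in terms of log-densities. -/
def logitField (μ : ∀ i, Measure (A i)) [∀ i, IsFiniteMeasure (μ i)] (ψ : C(∀ i, A i, ℝ))
    (v : ∀ i, C(A i, ℝ)) (i : ι) : C(A i, ℝ) :=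
  softmax (μ i) (gibbsPayoff μ ψ v i) * (-v i).pexp - 1

theorem continuous_logitField (ψ : C(∀ i, A i, ℝ)) : Continuous (logitField μ ψ) := by
  refine continuous_pi fun i => ((continuous_softmax.comp
    ((continuous_apply i).comp (contDiff_gibbsPayoff ψ).continuous)).mul ?_).sub continuous_const
  exact ContinuousMap.contDiff_pexp.continuous.comp (continuous_apply i).neg

variable [∀ i, (μ i).IsOpenPosMeasure]

/-- The free energy increases along the logit response dynamics, strictly so except at
equilibria. -/
theorem fderiv_productFreeEnergy_logitField (ψ : C(∀ i, A i, ℝ)) {v : ∀ i, C(A i, ℝ)}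
    (hv : ∀ i, partitionFunction (μ i) (v i) = 1) :
    0 ≤ fderiv ℝ (productFreeEnergy μ ψ) v (logitField μ ψ v) ∧
      (fderiv ℝ (productFreeEnergy μ ψ) v (logitField μ ψ v) = 0 →
        ∀ i, softmax (μ i) (gibbsPayoff μ ψ v i) = (v i).pexp) := by
  -- Weighted by the current density, the field is response density minus current density, as the
  -- chain rule for the logarithm requires.
  have hexp : ∀ i x, (v i).pexp x * logitField μ ψ v i x
      = softmax (μ i) (gibbsPayoff μ ψ v i) x - (v i).pexp x := by
    intro i x
    have h1 : Real.exp (v i x) * Real.exp (-v i x) = 1 := by rw [← Real.exp_add]; simp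
    simp only [logitField, ContinuousMap.sub_apply, ContinuousMap.mul_apply,
      ContinuousMap.pexp_apply, ContinuousMap.neg_apply, ContinuousMap.one_apply]
    linear_combination (softmax (μ i) (gibbsPayoff μ ψ v i) x) * h1
  set w : ∀ i, C(A i, ℝ) := fun i => gibbsPayoff μ ψ v i
    - ContinuousMap.const _ (Real.log (partitionFunction (μ i) (gibbsPayoff μ ψ v i))) with hw
  have hws : ∀ i x, softmax (μ i) (gibbsPayoff μ ψ v i) x = Real.exp (w i x) := by
    intro i x
    rw [← Real.exp_log (softmax_pos (μ := μ i) (gibbsPayoff μ ψ v i) x), log_softmax]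
    rfl
  -- With `w` the log-density of the response, this is the integrand of the symmetrized relative
  -- entropy; it is nonnegative since `exp` is increasing.
  set g : ∀ i, C(A i, ℝ) := fun i => ((w i).pexp - (v i).pexp) * (w i - v i) with hg
  have hg0 : ∀ i x, 0 ≤ g i x := by
    intro i x
    simp only [hg, ContinuousMap.mul_apply, ContinuousMap.sub_apply, ContinuousMap.pexp_apply]
    rcases le_total (w i x) (v i x) with h | h
    · exact mul_nonneg_of_nonpos_of_nonpos (sub_nonpos.2 (Real.exp_le_exp.2 h)) (sub_nonpos.2 h)
    · exact mul_nonneg (sub_nonneg.2 (Real.exp_le_exp.2 h)) (sub_nonneg.2 h)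
  have hmass : ∀ i, ∫ x, (v i).pexp x ∂(μ i) = 1 := fun i => by
    rw [← hv i, partitionFunction_eq]; rfl
  have hformula : fderiv ℝ (productFreeEnergy μ ψ) v (logitField μ ψ v)
      = ∑ i, ∫ x, g i x ∂(μ i) := by
    rw [fderiv_productFreeEnergy]
    refine Finset.sum_congr rfl fun i _ => ?_
    -- Mass conservation. It kills the product of means, and lets the payoff be replaced by its
    -- normalization `w`.
    have h1 : ∫ x, logitField μ ψ v i x ∂((μ i).tilted (v i)) = 0 := by
      rw [integral_tilted_continuousMap, hv, inv_one, one_smul]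
      simp_rw [smul_eq_mul, hexp]
      rw [integral_sub ((softmax (μ i) (gibbsPayoff μ ψ v i)).integrable _)
        ((v i).pexp.integrable _), integral_softmax, hmass, sub_self]
    rw [h1, zero_mul, sub_zero]
    have h2 : ∫ x, (w i x - gibbsPayoff μ ψ v i x) * logitField μ ψ v i x
        ∂((μ i).tilted (v i)) = 0 := by
      have h3 : ∀ x, w i x - gibbsPayoff μ ψ v i x
          = -Real.log (partitionFunction (μ i) (gibbsPayoff μ ψ v i)) := fun x => by
        simp [hw]
      simp_rw [h3]
      rw [integral_const_mul, h1, mul_zero]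
    have hint : ∀ f : C(A i, ℝ), Integrable f ((μ i).tilted (v i)) := fun f =>
      integrable_tilted_continuousMap (f.integrable _) _
    have h4 : ∫ x, logitField μ ψ v i x * (gibbsPayoff μ ψ v i x - v i x) ∂((μ i).tilted (v i))
        = ∫ x, logitField μ ψ v i x * (w i x - v i x) ∂((μ i).tilted (v i)) := by
      rw [← sub_eq_zero, ← integral_sub
        (f := fun x => logitField μ ψ v i x * (gibbsPayoff μ ψ v i x - v i x))
        (g := fun x => logitField μ ψ v i x * (w i x - v i x))
        (hint (logitField μ ψ v i * (gibbsPayoff μ ψ v i - v i)))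
        (hint (logitField μ ψ v i * (w i - v i))), ← neg_eq_zero, ← integral_neg, ← h2]
      refine integral_congr_ae (ae_of_all _ fun x => ?_)
      simp only
      ring
    rw [h4, integral_tilted_continuousMap, hv, inv_one, one_smul]
    refine integral_congr_ae (ae_of_all _ fun x => ?_)
    simp only [smul_eq_mul, hg, ContinuousMap.mul_apply, ContinuousMap.sub_apply]
    rw [← mul_assoc, hexp, hws]
    rfl
  rw [hformula]
  have hnn : ∀ i, 0 ≤ ∫ x, g i x ∂(μ i) := fun i => integral_nonneg (hg0 i)
  refine ⟨Finset.sum_nonneg fun i _ => hnn i, fun h0 i => ?_⟩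
  have h1 := (Finset.sum_eq_zero_iff_of_nonneg fun i _ => hnn i).1 h0 i (Finset.mem_univ i)
  have h2 := (integral_eq_zero_iff_of_nonneg (hg0 i) ((g i).integrable _)).1 h1
  have h3 := ((g i).continuous.ae_eq_iff_eq (μ i) continuous_zero).1 h2
  ext x
  rw [hws]
  have h4 := congrFun h3 x
  simp only [hg, ContinuousMap.mul_apply, ContinuousMap.sub_apply, ContinuousMap.pexp_apply,
    Pi.zero_apply] at h4
  rcases mul_eq_zero.1 h4 with h | h
  · exact sub_eq_zero.1 h
  · rw [sub_eq_zero.1 h]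
    rfl

end Dissipation

/-! ### Uniform positivity of the response densities. -/

section SoftmaxHull

variable {X : Type*} [MetricSpace X] [CompactSpace X] [MeasurableSpace X] [BorelSpace X]

/-- The closed convex hull of the normalized exponentials of a compact set of functions consists
of probability densities bounded away from zero. -/
theorem exists_lower_bound_closedConvexHull_softmax (μ : Measure X) [IsFiniteMeasure μ]
    [NeZero μ] {K : Set C(X, ℝ)} (hK : IsCompact K) :
    ∃ m > 0, ∀ p ∈ closedConvexHull ℝ (softmax μ '' K), (∀ x, m ≤ p x) ∧ ∫ x, p x ∂μ = 1 := by
  obtain ⟨m, hm, hmK⟩ := (hK.prod isCompact_univ).exists_forall_le'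
    (f := fun q : C(X, ℝ) × X => softmax μ q.1 q.2) (a := 0)
    (by
      refine Continuous.continuousOn ?_
      exact ContinuousEval.continuous_eval.comp
        ((continuous_softmax.comp continuous_fst).prodMk continuous_snd))
    (fun q _ => softmax_pos q.1 q.2)
  refine ⟨m, hm, ?_⟩
  set I := weightedIntegral μ (fun _ => (1 : ℝ)) (integrable_const 1) with hI
  have hIa : ∀ p : C(X, ℝ), I p = ∫ x, p x ∂μ := fun p => by simp [hI, weightedIntegral_apply]
  -- Both the lower bound and unit mass are closed convex conditions, so they pass to the closed
  -- convex hull.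
  have hsub : closedConvexHull ℝ (softmax μ '' K) ⊆
      (⋂ x, {p : C(X, ℝ) | m ≤ ContinuousMap.evalCLM ℝ x p}) ∩ {p | I p = 1} := by
    refine closedConvexHull_min ?_ ?_ ?_
    · rintro _ ⟨f, hf, rfl⟩
      refine ⟨mem_iInter.2 fun x => hmK (f, x) ⟨hf, mem_univ x⟩, ?_⟩
      rw [mem_ofPred_eq, hIa, integral_softmax]
    · refine Convex.inter (convex_iInter fun x => ?_) ?_
      · exact convex_halfSpace_ge (ContinuousMap.evalCLM ℝ x).toLinearMap.isLinear m
      · exact convex_hyperplane I.toLinearMap.isLinear 1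
    · refine IsClosed.inter (isClosed_iInter fun x => ?_) ?_
      · exact isClosed_le continuous_const (ContinuousMap.evalCLM ℝ x).continuous
      · exact isClosed_eq I.continuous continuous_const
  intro p hp
  obtain ⟨h1, h2⟩ := hsub hp
  exact ⟨fun x => mem_iInter.1 h1 x, by rw [← hIa]; exact h2⟩

/-- The logarithm of a function, truncated from below at `m`. -/
def truncLog (m : ℝ) (hm : 0 < m) (p : C(X, ℝ)) : C(X, ℝ) :=
  ContinuousMap.comp ⟨fun y => Real.log (max m y), (continuous_const.max continuous_id).log
    fun y => (lt_max_of_lt_left hm).ne'⟩ p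

theorem continuous_truncLog (m : ℝ) (hm : 0 < m) :
    Continuous (truncLog m hm : C(X, ℝ) → C(X, ℝ)) :=
  ContinuousMap.continuous_postcomp _

/-- The truncation makes the logarithm continuous on all of `C(X, ℝ)` and is inactive on functions
bounded below by `m`. -/
theorem pexp_truncLog {m : ℝ} (hm : 0 < m) {p : C(X, ℝ)} (hp : ∀ x, m ≤ p x) :
    (truncLog m hm p).pexp = p := by
  ext x
  change Real.exp (Real.log (max m (p x))) = p x
  rw [max_eq_right (hp x), Real.exp_log (hm.trans_le (hp x))]

end SoftmaxHull

/-! ### Profiles described by log-densities. -/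

namespace ContinuousActionGame

variable {N : ℕ} {G : ContinuousActionGame N}

variable (G) in
/-- The signed measure profile with densities `exp (v i)`. -/
def expProfile (v : ∀ i, C(G.Action i, ℝ)) : G.SignedProfile :=
  fun i => densityBL (G.lebesgue i) (v i).pexp

theorem continuous_expProfile : Continuous G.expProfile :=
  continuous_pi fun i => (densityBL (G.lebesgue i)).continuous.comp
    (ContinuousMap.contDiff_pexp.continuous.comp (continuous_apply i))

theorem expProfile_injective : Function.Injective G.expProfile := by
  intro v w h
  ext i x
  have h1 := densityBL_injective (G.lebesgue i) (congrFun h i)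
  exact Real.exp_injective (congrArg (fun f : C(G.Action i, ℝ) => f x) h1)

theorem continuous_toSigned : Continuous G.toSigned :=
  continuous_pi fun i => (isometry_iff_dist_eq.2 fun _ _ => rfl :
    Isometry (MixedStrategy.toBL : MixedStrategy (G.Action i) → _)).continuous.comp
      (continuous_apply i)

theorem toSigned_injective : Function.Injective G.toSigned := fun _ _ h =>
  funext fun i => MixedStrategy.toBL_injective (congrFun h i)

/-- The action measures of a profile given by normalized log-densities are Gibbs measures. -/
theorem toMeasure_of_toSigned_eq {π : G.Profile} {v : ∀ i, C(G.Action i, ℝ)}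
    (hv : ∀ i, partitionFunction (G.lebesgue i) (v i) = 1) (h : G.toSigned π = G.expProfile v)
    (i : Fin N) : (π i).toMeasure = (G.lebesgue i).tilted (v i) := by
  have hp := isProbabilityMeasure_tilted_continuousMap (μ := G.lebesgue i) (v i)
  have h1 : (π i).toBL = MixedStrategy.toBL ⟨(G.lebesgue i).tilted (v i), hp⟩ := by
    rw [toBL_tilted, softmax, hv, inv_one, one_smul]
    exact congrFun h i
  rw [MixedStrategy.toBL_injective h1]

section LogitResponse

variable {φ : C((i : Fin N) → G.Action i, ℝ)}

theorem toBL_logitResponse (hφ : G.IsContinuousPotential φ) (η : ℝ) (π : G.Profile) (i : Fin N) :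
    (G.logitResponse η π i).toBL = densityBL (G.lebesgue i) (softmax (G.lebesgue i)
      (∫ b, payoffAgainst (η⁻¹ • φ) i b ∂(Measure.pi fun j => (π j).toMeasure))) := by
  have hp := isProbabilityMeasure_tilted_continuousMap (μ := G.lebesgue i)
    (∫ b, payoffAgainst (η⁻¹ • φ) i b ∂(Measure.pi fun j => (π j).toMeasure))
  rw [← toBL_tilted _ hp]
  congr 1
  exact MixedStrategy.ext (logitResponse_toMeasure hφ η π i)

theorem toSigned_logitResponse (hφ : G.IsContinuousPotential φ) (η : ℝ) {π : G.Profile}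
    {v : ∀ i, C(G.Action i, ℝ)}
    (hv : ∀ i, partitionFunction (G.lebesgue i) (v i) = 1) (h : G.toSigned π = G.expProfile v)
    (i : Fin N) : G.toSigned (G.logitResponse η π) i = densityBL (G.lebesgue i)
      (softmax (G.lebesgue i) (gibbsPayoff G.lebesgue (η⁻¹ • φ) v i)) := by
  rw [toSigned, toBL_logitResponse hφ, gibbsPayoff, ← pi_tilted]
  simp_rw [toMeasure_of_toSigned_eq hv h]

theorem mem_logitEquilibria_iff (hφ : G.IsContinuousPotential φ) (η : ℝ) {π : G.Profile}
    {v : ∀ i, C(G.Action i, ℝ)}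
    (hv : ∀ i, partitionFunction (G.lebesgue i) (v i) = 1) (h : G.toSigned π = G.expProfile v) :
    π ∈ G.logitEquilibria η ↔ ∀ i, softmax (G.lebesgue i)
      (gibbsPayoff G.lebesgue (η⁻¹ • φ) v i) = (v i).pexp := by
  rw [logitEquilibria, mem_ofPred_eq, ← toSigned_injective.eq_iff, funext_iff]
  refine forall_congr' fun i => ?_
  rw [toSigned_logitResponse hφ η hv h, h, expProfile, (densityBL_injective _).eq_iff]

/-- The densities of the logit responses lie in a compact convex set of probability densities
bounded away from zero, and so do those of the profiles in a compact invariant set. -/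
theorem exists_compact_logDensities (hφ : G.IsContinuousPotential φ) {η : ℝ}
    {Φ : Flow ℝ≥0 G.Profile} (hΦ : G.IsLogitFlow η Φ) {Λ : Set G.Profile} (hΛ : IsCompact Λ)
    (hinv : ∀ t, Φ t '' Λ = Λ) :
    ∃ D : Set (∀ i, C(G.Action i, ℝ)), IsCompact D ∧
      (∀ v ∈ D, ∀ i, partitionFunction (G.lebesgue i) (v i) = 1) ∧
      ∀ π ∈ Λ, ∃ v ∈ D, G.toSigned π = G.expProfile v := by
  -- Expected payoffs are averages over the compact range of `payoffAgainst`, so they lie in this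
  -- hull for every profile, with or without a density.
  set K : ∀ i, Set C(G.Action i, ℝ) := fun i =>
    closedConvexHull ℝ (range (payoffAgainst (η⁻¹ • φ) i)) with hK
  have hKc : ∀ i, IsCompact (K i) := fun i =>
    isCompact_closedConvexHull (isCompact_range (payoffAgainst (η⁻¹ • φ) i).continuous)
  have hmean : ∀ (π : G.Profile) i,
      ∫ b, payoffAgainst (η⁻¹ • φ) i b ∂(Measure.pi fun j => (π j).toMeasure) ∈ K i :=
    fun π i => convex_closedConvexHull.integral_mem isClosed_closedConvexHull
      (ae_of_all _ fun b => subset_closedConvexHull (mem_range_self b))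
      (integrable_payoffAgainst _ i _)
  set P : ∀ i, Set C(G.Action i, ℝ) := fun i =>
    closedConvexHull ℝ (softmax (G.lebesgue i) '' K i) with hP
  have hPc : ∀ i, IsCompact (P i) := fun i =>
    isCompact_closedConvexHull ((hKc i).image continuous_softmax)
  choose m hm hmP using fun i =>
    exists_lower_bound_closedConvexHull_softmax (G.lebesgue i) (hKc i)
  have hmem : ∀ π ∈ Λ, G.toSigned π ∈ univ.pi fun i => densityBL (G.lebesgue i) '' P i := by
    intro π hπ
    refine mem_of_relaxation (τ := G.toSigned) (L := fun π => G.toSigned (G.logitResponse η π))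
      continuous_toSigned ?_ ?_ (fun π => ?_) hΦ hΛ hinv hπ
    · exact convex_pi fun i _ => convex_closedConvexHull.is_linear_image
        (densityBL (G.lebesgue i)).toLinearMap.isLinear
    · exact isClosed_set_pi fun i _ =>
        ((hPc i).image (densityBL (G.lebesgue i)).continuous).isClosed
    · intro i _
      exact ⟨_, subset_closedConvexHull (mem_image_of_mem _ (hmean π i)),
        (toBL_logitResponse hφ η π i).symm⟩
  refine ⟨univ.pi fun i => truncLog (m i) (hm i) '' P i,
    isCompact_univ_pi fun i => (hPc i).image (continuous_truncLog _ _), ?_, fun π hπ => ?_⟩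
  · intro v hv i
    obtain ⟨p, hp, hpv⟩ := hv i (mem_univ i)
    rw [partitionFunction_eq, ← (hmP i p hp).2, ← hpv]
    exact integral_congr_ae (ae_of_all _ fun x =>
      congrArg (fun f : C(G.Action i, ℝ) => f x) (pexp_truncLog (hm i) (hmP i p hp).1))
  · choose p hp hpπ using fun i => hmem π hπ i (mem_univ i)
    refine ⟨fun i => truncLog (m i) (hm i) (p i), fun i _ => mem_image_of_mem _ (hp i), ?_⟩
    ext1 i
    rw [expProfile, pexp_truncLog (hm i) (hmP i _ (hp i)).1, hpπ]

end LogitResponse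

end ContinuousActionGame

/-! ### The differential equation for log-densities. -/

namespace ContinuousActionGame

variable {N : ℕ} {G : ContinuousActionGame N} {φ : C((i : Fin N) → G.Action i, ℝ)}

/-- Trajectories of the logit dynamics with continuous log-densities `v` solve the differential
equation `v' = logitField v` in the uniform norm. -/
theorem hasDerivWithinAt_logDensity (hφ : G.IsContinuousPotential φ) {η : ℝ}
    {Φ : Flow ℝ≥0 G.Profile} (hΦ : G.IsLogitFlow η Φ) (π : G.Profile)
    {v : ℝ → ∀ i, C(G.Action i, ℝ)} (hv : Continuous v)
    (hv1 : ∀ t i, partitionFunction (G.lebesgue i) (v t i) = 1)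
    (hvπ : ∀ t : ℝ, G.toSigned (Φ t.toNNReal π) = G.expProfile (v t)) {t : ℝ} (ht : 0 ≤ t) :
    HasDerivWithinAt v (logitField G.lebesgue (η⁻¹ • φ) (v t)) (Ici 0) t := by
  set ψ := η⁻¹ • φ with hψ
  have hpc : Continuous fun s => fun i => (v s i).pexp := continuous_pi fun i =>
    ContinuousMap.contDiff_pexp.continuous.comp ((continuous_apply i).comp hv)
  have hlc : Continuous fun s => fun i => softmax (G.lebesgue i) (gibbsPayoff G.lebesgue ψ (v s) i) :=
    continuous_pi fun i => continuous_softmax.comp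
      ((continuous_apply i).comp ((contDiff_gibbsPayoff ψ).continuous.comp hv))
  -- The derivative is known only in the bounded Lipschitz norm. It upgrades to the uniform norm
  -- because the right-hand side is uniformly continuous in the sense of `C(X, ℝ)`-valued continuity
  -- in time, and `densityBL` is injective.
  have hp : ∀ t : ℝ, 0 ≤ t → HasDerivWithinAt (fun s => fun i => (v s i).pexp)
      ((fun i => softmax (G.lebesgue i) (gibbsPayoff G.lebesgue ψ (v t) i)) -
        fun i => (v t i).pexp) (Ici 0) t := by
    intro t ht
    refine hasDerivWithinAt_of_separating (J := Fin N)
      (fun i => (densityBL (G.lebesgue i)).comp (ContinuousLinearMap.proj i)) (fun x hx => ?_)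
      (hlc.sub hpc) (fun i t ht => ?_) ht
    · ext1 i
      refine densityBL_injective (G.lebesgue i) ?_
      rw [Pi.zero_apply, map_zero]
      exact hx i
    · have h1 := hΦ π t.toNNReal
      rw [Real.coe_toNNReal t ht] at h1
      have h2 := hasDerivWithinAt_pi.1 h1 i
      simp_rw [hvπ] at h2
      rw [Pi.sub_apply, toSigned_logitResponse hφ η (hv1 t) (hvπ t)] at h2
      refine h2.congr_deriv ?_
      exact ((densityBL (G.lebesgue i)).map_sub _ _).symm
  -- The logarithm is differentiated pointwise; point evaluations separate, and `logitField` is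
  -- continuous, which gives the uniform norm again.
  refine hasDerivWithinAt_of_separating (J := Σ i, G.Action i)
    (fun j => (ContinuousMap.evalCLM ℝ j.2).comp (ContinuousLinearMap.proj j.1)) (fun x hx => ?_)
    ((continuous_logitField ψ).comp hv) (fun j t ht => ?_) ht
  · ext i y
    exact hx ⟨i, y⟩
  · obtain ⟨i, y⟩ := j
    have h1 := (((ContinuousMap.evalCLM ℝ y).comp (ContinuousLinearMap.proj i) :
      (∀ i, C(G.Action i, ℝ)) →L[ℝ] ℝ).hasFDerivAt.comp_hasDerivWithinAt t (hp t ht)).log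
        (Real.exp_ne_zero (v t i y))
    refine (h1.congr_of_eventuallyEq (Eventually.of_forall fun s => ?_) ?_).congr_deriv ?_
    · exact (Real.log_exp (v s i y)).symm
    · exact (Real.log_exp (v t i y)).symm
    · change (softmax (G.lebesgue i) (gibbsPayoff G.lebesgue ψ (v t) i) y - Real.exp (v t i y)) /
        Real.exp (v t i y) = softmax (G.lebesgue i) (gibbsPayoff G.lebesgue ψ (v t) i) y *
          Real.exp (-v t i y) - 1
      rw [Real.exp_neg, sub_div, div_self (Real.exp_ne_zero _), div_eq_mul_inv]

end ContinuousActionGame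

/-- A function with nonnegative derivative on `[0, ∞)` is nondecreasing, and it increases strictly
from `0` if its derivative at `0` is positive. -/
theorem le_and_lt_of_hasDerivWithinAt {f f' : ℝ → ℝ}
    (hf : ∀ t, 0 ≤ t → HasDerivWithinAt f (f' t) (Ici 0) t) (hf' : ∀ t, 0 ≤ t → 0 ≤ f' t) :
    (∀ t, 0 ≤ t → f 0 ≤ f t) ∧ (0 < f' 0 → f 0 < f 1) := by
  have hmono : MonotoneOn f (Ici 0) :=
    monotoneOn_of_hasDerivWithinAt_nonneg (convex_Ici 0) (fun t ht => (hf t ht).continuousWithinAt)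
      (fun t ht => (hf t (interior_subset ht)).mono interior_subset)
      fun t ht => hf' t (interior_subset ht)
  refine ⟨fun t ht => hmono (mem_Ici.2 le_rfl) ht ht, fun h0 => ?_⟩
  have h1 := (hasDerivWithinAt_iff_tendsto_slope.1 (hf 0 le_rfl)).eventually (lt_mem_nhds h0)
  rw [Ici_sdiff_left] at h1
  obtain ⟨t, ht, ht0, ht1⟩ := (h1.and (Ioo_mem_nhdsGT one_pos)).exists
  rw [slope_def_field, sub_zero] at ht
  have h2 : f 0 < f t := by
    have := (div_pos_iff_of_pos_right ht0).1 ht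
    linarith
  exact h2.trans_le (hmono ht0.le (mem_Ici.2 zero_le_one) ht1.le)

end

/-! ### Assembly of the theorem. -/

theorem mainTheorem2 {N : ℕ} (G : ContinuousActionGame N) (hG : G.IsPotentialGame)
    (η : ℝ) (hη : 0 < η) (hiso : G.HasIsolatedEquilibriumComponents η)
    (Φ : Flow ℝ≥0 G.Profile) (hΦ : G.IsLogitFlow η Φ)
    (Λ : Set G.Profile) (hΛ : IsInternallyChainTransitive Φ Λ) :
    ∃ π ∈ G.logitEquilibria η, Λ ⊆ connectedComponentIn (G.logitEquilibria η) π := by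
  obtain ⟨φ, hφ⟩ := hG.exists_continuous
  set ψ := η⁻¹ • φ with hψ
  obtain ⟨D, hD, hD1, hDΛ⟩ :=
    ContinuousActionGame.exists_compact_logDensities hφ hΦ hΛ.2.1 hΛ.2.2.1
  -- The lift `l` is arbitrary outside `Λ`; only its values on `Λ` are used, and `Λ` is invariant.
  choose! l hlD hl using hDΛ
  have hlc : ContinuousOn l Λ := continuousOn_lift hD
    ContinuousActionGame.continuous_expProfile ContinuousActionGame.expProfile_injective
    ContinuousActionGame.continuous_toSigned.continuousOn hlD fun π hπ => (hl π hπ).symm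
  have hl1 : ∀ π ∈ Λ, ∀ i, partitionFunction (G.lebesgue i) (l π i) = 1 :=
    fun π hπ => hD1 _ (hlD π hπ)
  set V : G.Profile → ℝ := fun π => productFreeEnergy G.lebesgue ψ (l π) with hV
  have hVc : ContinuousOn V Λ := (contDiff_productFreeEnergy ψ).continuous.comp_continuousOn hlc
  have htraj : ∀ π ∈ Λ, ∀ t : ℝ, 0 ≤ t → HasDerivWithinAt (fun s : ℝ => V (Φ s.toNNReal π))
      (fderiv ℝ (productFreeEnergy G.lebesgue ψ) (l (Φ t.toNNReal π))
        (logitField G.lebesgue ψ (l (Φ t.toNNReal π)))) (Ici 0) t := by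
    intro π hπ t ht
    have hmem : ∀ s : ℝ, Φ s.toNNReal π ∈ Λ := fun s => hΛ.flow_mem hπ _
    have hc : Continuous fun s : ℝ => l (Φ s.toNNReal π) := hlc.comp_continuous
      (Φ.continuous continuous_real_toNNReal continuous_const) hmem
    have h1 := ContinuousActionGame.hasDerivWithinAt_logDensity hφ hΦ π hc
      (fun s => hl1 _ (hmem s)) (fun s => hl _ (hmem s)) ht
    exact ((contDiff_productFreeEnergy ψ).differentiable (by simp)
      _).hasFDerivAt.comp_hasDerivWithinAt t h1
  have hdiss := fun π (hπ : π ∈ Λ) => fderiv_productFreeEnergy_logitField ψ (hl1 π hπ)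
  have hincr := fun π (hπ : π ∈ Λ) => le_and_lt_of_hasDerivWithinAt (htraj π hπ)
    fun t _ => (hdiss _ (hΛ.flow_mem hπ _)).1
  have hequil : ∀ π ∈ Λ, π ∈ G.logitEquilibria η ↔ ∀ i, softmax (G.lebesgue i)
      (gibbsPayoff G.lebesgue ψ (l π) i) = (l π i).pexp := fun π hπ =>
    ContinuousActionGame.mem_logitEquilibria_iff hφ η (hl1 π hπ) (hl π hπ)
  have hsub : Λ ⊆ G.logitEquilibria η := by
    refine hΛ.subset_of_lyapunov hVc (fun π hπ t => ?_) (fun π hπ hπS => ?_) ?_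
    · have := (hincr π hπ).1 t t.2
      simpa [Φ.map_zero_apply] using this
    · have := (hincr π hπ).2 ((hdiss _ (hΛ.flow_mem hπ _)).1.lt_of_ne fun h0 => ?_)
      · simpa [Φ.map_zero_apply] using this
      · refine hπS ((hequil π hπ).2 ((hdiss π hπ).2 ?_))
        simpa [Φ.map_zero_apply] using h0.symm
    · refine measure_mono_null ?_ (volume_image_equilibriumLogDensities (μ := G.lebesgue) ψ)
      rintro _ ⟨π, ⟨hπ, hπS⟩, rfl⟩
      -- Taking logarithms in the fixed point equation, the additive constant is minus the log
      -- partition function of the payoff.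
      refine ⟨l π, ⟨fun i => -Real.log (partitionFunction (G.lebesgue i)
        (gibbsPayoff G.lebesgue ψ (l π) i)), fun i => ?_⟩, rfl⟩
      ext x
      have h1 := congrArg (fun f : C(G.Action i, ℝ) => Real.log (f x)) ((hequil π hπ).1 hπS i)
      simp only [log_softmax, ContinuousMap.pexp_apply, Real.log_exp] at h1
      rw [ContinuousMap.add_apply, ContinuousMap.const_apply, ← h1]
      ring
  have hrest : ∀ π ∈ Λ, ∀ t, Φ t π = π := by
    intro π hπ t
    have hd : ∀ s ∈ Ici (0 : ℝ), HasDerivWithinAt (fun s : ℝ => G.toSigned (Φ s.toNNReal π)) 0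
        (Ici 0) s := by
      intro s hs
      have h1 := hΦ π s.toNNReal
      have h2 : G.logitResponse η (Φ s.toNNReal π) = Φ s.toNNReal π := hsub (hΛ.flow_mem hπ _)
      rwa [h2, sub_self, Real.coe_toNNReal s hs] at h1
    have h3 := (convex_Ici (0 : ℝ)).is_const_of_fderivWithin_eq_zero (𝕜 := ℝ)
      (fun s hs => (hd s hs).differentiableWithinAt) (fun s hs => by
        rw [(hd s hs).hasFDerivWithinAt.fderivWithin (uniqueDiffOn_Ici 0 s hs)]
        ext
        simp) (mem_Ici.2 t.2) (mem_Ici.2 le_rfl)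
    have h4 := ContinuousActionGame.toSigned_injective h3
    simpa [Φ.map_zero_apply] using h4
  obtain ⟨π, hπ⟩ := hΛ.1
  exact ⟨π, hsub hπ, (hΛ.isPreconnected hrest).subset_connectedComponentIn hπ hsub⟩
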